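/- Let $M$ be a smooth (Hausdorff, second countable) manifold without boundary of finite dimension $n\ge 1$. Write $TM$, $TTM$, $TTTM,\dots$ for its iterated tangent bundles. For a smooth curve $\gamma$ in a manifold, $\gamma'$ denotes its tangent curve in the tangent bundle, and $\gamma''=(\gamma')'$. For a manifold $N$ let $\kappa\colon TTN\to TTN$ be the canonical involution, characterized by $\partial_t\partial_s c=\kappa\circ\partial_s\partial_t c$ for smooth maps $c(t,s)$ into $N$; in induced coordinates, $\kappa(x,y,X,Y)=(x,X,y,Y)$. A *spray* on $M$ is a smooth vector field $S$ on $TM\setminus 0$ with $D\pi\circ S=\operatorname{id}$, where $\pi\colon TM\to M$ is the projection, and $[E,S]=S$, where $E(\xi)=\partial_s((1+s)\xi)|_{s=0}$ is the Liouville vector field. The *complete lift* of a vector field $S$ defined on an open subset of $TN$ is $S^c=D\kappa\circ\kappa\circ DS\circ\kappa$ (with the canonical involutions of $TTN$, $TTTN$, $TTN$, from left to right), a partially defined map $TTN\to TTTN$; $S^{cc}=(S^c)^c$. A smooth curve $\gamma$ in $N=M$, $TM$ or $TTM$ is *regular* if its projection to $M$ has nowhere vanishing tangent, and a regular curve is a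 *geodesic* of $S$, $S^c$ or $S^{cc}$, respectively, if $\gamma''=S\circ\gamma'$, $\gamma''=S^c\circ\gamma'$ or $\gamma''=S^{cc}\circ\gamma'$, respectively. A *parallel Jacobi field* of a spray $S$ on $M$ on an open interval $I\ni 0$ is a curve $J\colon I\to TM$ of the form $J(t)=\alpha c'(t)+\beta t\,c'(t)$ with $\alpha,\beta\in\mathbb R$ and $c\colon I\to M$ a geodesic of $S$. Let $$\Delta=\{(\kappa\circ J')'(0) : J\colon(-\varepsilon,\varepsilon)\to TM \text{ is a parallel Jacobi field of } S,\ \varepsilon>0\}\subset TTTM .$$ A *geodesic in $P=(S^{cc},TTM,\Delta)$* is a geodesic $\gamma\colon I\to TTM$ of $S^{cc}$ on an open interval $I\ni 0$ such that $\gamma'(t_0)\in\Delta$ for some $t_0\in I$. **Proposition.** Let $S$ be a spray on $M$, let $I_1,I_2$ be open intervals (possibly unbounded) containing $0$, and let $\gamma_1\colon I_1\to TTM$ and $\gamma_2\colon I_2\to TTM$ be geodesics in $P$ with $\gamma_1(0)=\gamma_2(0)$. Then $\gamma_1=\gamma_2$ on $I_1\cap I_2$. In other words, a geodesic in $P$ is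 determined by its initial point. -/

import Mathlib

open scoped Manifold ContDiff

noncomputable section

namespace SprayGeometry

section Iterated

variable {E : Type*} [NormedAddCommGroup E] [NormedSpace ℝ E]
  {H : Type*} [TopologicalSpace H] (I : ModelWithCorners ℝ E H)
  {N : Type*} [TopologicalSpace N] [ChartedSpace H N] [IsManifold I ∞ N]

/-- The tangent `γ'` of a curve `γ` in `N`, as a curve in `TN`. -/
def velocity (γ : ℝ → N) (t : ℝ) : TangentBundle I N :=
  ⟨γ t, mfderiv 𝓘(ℝ, ℝ) I γ t (1 : ℝ)⟩

/-- The canonical involution `κ` of `TTN`, given in induced coordinates `(x, y, X, Y)` by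
`κ (x, y, X, Y) = (x, X, y, Y)`.  The preferred chart of `TN` at `(x, y)` is the one induced by
the preferred chart of `N` at `x`, so the fibre component of a point of `TTN` over `(x, y)` is the
pair `(X, Y)` of induced coordinates with respect to the preferred chart at `x`, in which the
fibre component of a point of `TN` over `x` is also expressed. -/
def canonicalInvolution (ξ : TangentBundle I.tangent (TangentBundle I N)) :
    TangentBundle I.tangent (TangentBundle I N) :=
  let y : E := ξ.proj.snd
  let XY : E × E := ξ.snd
  ⟨⟨ξ.proj.proj, XY.1⟩, (y, XY.2)⟩

/-- The complete lift `S^c = Dκ ∘ κ ∘ DS ∘ κ` of a vector field `S` on (an open subset of) `TN`,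
regarded as a map `TN → TTN`.  It is a map `TTN → TTTN`. -/
def completeLift (S : TangentBundle I N → TangentBundle I.tangent (TangentBundle I N))
    (ξ : TangentBundle I.tangent (TangentBundle I N)) :
    TangentBundle I.tangent.tangent (TangentBundle I.tangent (TangentBundle I N)) :=
  tangentMap I.tangent.tangent I.tangent.tangent (canonicalInvolution I (N := N))
    (canonicalInvolution I.tangent
      (tangentMap I.tangent I.tangent.tangent S (canonicalInvolution I ξ)))

variable (N) in
/-- The Liouville vector field of `TN`; in induced coordinates `E (x, y) = (x, y, 0, y)`. -/
def liouville (ξ : TangentBundle I N) : TangentSpace I.tangent ξ :=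
  let y : E := ξ.snd
  ((0, y) : E × E)

variable (N) in
/-- The slashed tangent bundle `TN ∖ 0`. -/
def slashed : Set (TangentBundle I N) := {ξ | ξ.snd ≠ 0}

theorem chart_velocity (q : TangentBundle I N) (γ : ℝ → N) (t : ℝ)
    (hγ : MDifferentiableAt 𝓘(ℝ, ℝ) I γ t) (hs : γ t ∈ (chartAt H q.proj).source) :
    extChartAt I.tangent q (velocity I γ t) =
      (extChartAt I q.proj (γ t), fderiv ℝ (extChartAt I q.proj ∘ γ) t 1) := by
  have h1 := (hasMFDerivAt_extChartAt (I := I) hs).comp t hγ.hasMFDerivAt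
  have h2 := h1.mfderiv
  rw [mfderiv_eq_fderiv, mfderiv_chartAt_eq_tangentCoordChange hs] at h2
  rw [h2, ModelWithCorners.tangent, FiberBundle.extChartAt]
  rfl

theorem velocity_snd (γ : ℝ → N) (t : ℝ)
    (hγ : MDifferentiableAt 𝓘(ℝ, ℝ) I γ t) :
    (velocity I γ t).snd = fderiv ℝ (extChartAt I (γ t) ∘ γ) t 1 := by
  have h1 := (hasMFDerivAt_extChartAt (I := I) (mem_chart_source H (γ t))).comp t hγ.hasMFDerivAt
  have h2 := h1.mfderiv
  rw [mfderiv_eq_fderiv, mfderiv_chartAt_eq_tangentCoordChange (mem_chart_source H (γ t))] at h2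
  rw [h2]
  symm
  exact tangentCoordChange_self (I := I) (mem_extChartAt_source (I := I) (γ t))

theorem velocity_eq (γ : ℝ → N) (t : ℝ) (hγ : MDifferentiableAt 𝓘(ℝ, ℝ) I γ t) :
    velocity I γ t = ⟨γ t, fderiv ℝ (extChartAt I (γ t) ∘ γ) t 1⟩ := by
  rw [← velocity_snd I γ t hγ]; rfl

theorem second_velocity (c : ℝ × ℝ → N) (t₀ s₀ : ℝ)
    (hc : ContMDiffAt 𝓘(ℝ, ℝ × ℝ) I ∞ c (t₀, s₀)) :
    velocity I.tangent (fun t => velocity I (fun s => c (t, s)) s₀) t₀ =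
      ⟨⟨c (t₀, s₀), fderiv ℝ (extChartAt I (c (t₀, s₀)) ∘ c) (t₀, s₀) (0, 1)⟩,
       (fderiv ℝ (extChartAt I (c (t₀, s₀)) ∘ c) (t₀, s₀) (1, 0),
        fderiv ℝ (fderiv ℝ (extChartAt I (c (t₀, s₀)) ∘ c)) (t₀, s₀) (1, 0) (0, 1))⟩ := by
  set f : ℝ × ℝ → E := extChartAt I (c (t₀, s₀)) ∘ c with hf
  have hfs : ContDiffAt ℝ ∞ f (t₀, s₀) := by
    rw [← contMDiffAt_iff_contDiffAt]
    exact (contMDiffAt_extChartAt (I := I) (n := ∞)).comp (t₀, s₀) hc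
  have hev : ∀ᶠ p in nhds (t₀, s₀), MDifferentiableAt 𝓘(ℝ, ℝ × ℝ) I c p ∧
      c p ∈ (chartAt H (c (t₀, s₀))).source ∧ DifferentiableAt ℝ f p := by
    have h1 : ∀ᶠ p in nhds (t₀, s₀), ContMDiffAt 𝓘(ℝ, ℝ × ℝ) I 1 c p :=
      contMDiffAt_iff_contMDiffAt_nhds (by simp) |>.1 (hc.of_le (n := ∞) (m := 1) (by exact_mod_cast le_top))
    have h2 := hc.continuousAt.preimage_mem_nhds
      ((chartAt H (c (t₀, s₀))).open_source.mem_nhds (mem_chart_source H _))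
    have h3 : ∀ᶠ p in nhds (t₀, s₀), ContDiffAt ℝ 1 f p :=
      (hfs.of_le (by exact_mod_cast le_top)).eventually (by simp)
    filter_upwards [h1, h2, h3] with p a b d
    exact ⟨a.mdifferentiableAt one_ne_zero, b, d.differentiableAt one_ne_zero⟩
  have hev1 : ∀ᶠ t in nhds t₀, MDifferentiableAt 𝓘(ℝ, ℝ × ℝ) I c (t, s₀) ∧
      c (t, s₀) ∈ (chartAt H (c (t₀, s₀))).source ∧ DifferentiableAt ℝ f (t, s₀) :=
    (Continuous.tendsto (by fun_prop : Continuous fun t : ℝ => (t, s₀)) t₀).eventually hev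
  have hsl : ∀ t s, MDifferentiableAt 𝓘(ℝ, ℝ × ℝ) I c (t, s) →
      MDifferentiableAt 𝓘(ℝ, ℝ) I (fun s => c (t, s)) s := fun t s h =>
    h.comp s (f := fun s : ℝ => (t, s)) (by
      rw [mdifferentiableAt_iff_differentiableAt]; fun_prop)
  have hfd : ∀ t s, DifferentiableAt ℝ f (t, s) →
      fderiv ℝ (fun s => f (t, s)) s 1 = fderiv ℝ f (t, s) (0, 1) := fun t s h => by
    have : HasFDerivAt (fun s : ℝ => (t, s)) (ContinuousLinearMap.inr ℝ ℝ ℝ) s :=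
      hasFDerivAt_prodMk_right t s
    have := (h.hasFDerivAt.comp s this).fderiv
    erw [this]; simp
  have h0 := hev1.self_of_nhds
  have hVt : velocity I (fun s => c (t₀, s)) s₀ = ⟨c (t₀, s₀), fderiv ℝ f (t₀, s₀) (0, 1)⟩ := by
    rw [velocity_eq _ _ _ (hsl _ _ h0.1), ← hfd _ _ h0.2.2]; rfl
  have key : (extChartAt I.tangent (velocity I (fun s => c (t₀, s)) s₀) ∘
      fun t => velocity I (fun s => c (t, s)) s₀) =ᶠ[nhds t₀]
      fun t => (f (t, s₀), fderiv ℝ f (t, s₀) (0, 1)) := by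
    filter_upwards [hev1] with t ht
    simp only [Function.comp]
    rw [chart_velocity _ _ _ _ (hsl _ _ ht.1) ht.2.1, ← hfd _ _ ht.2.2]
    rfl
  have g1 : HasFDerivAt (fun t : ℝ => (t, s₀)) (ContinuousLinearMap.inl ℝ ℝ ℝ) t₀ :=
    hasFDerivAt_prodMk_left t₀ s₀
  have hdf : DifferentiableAt ℝ (fderiv ℝ f) (t₀, s₀) :=
    (((hfs.of_le (m := 2) ENat.LEInfty.out).fderiv_right (m := 1) (by norm_num)).differentiableAt one_ne_zero)
  have g2 := h0.2.2.hasFDerivAt.comp t₀ g1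
  have g3 := (hdf.hasFDerivAt.comp t₀ g1).clm_apply (hasFDerivAt_const ((0 : ℝ), (1 : ℝ)) t₀)
  have hV : MDifferentiableAt 𝓘(ℝ, ℝ) I.tangent (fun t => velocity I (fun s => c (t, s)) s₀) t₀ := by
    rw [ModelWithCorners.tangent, mdifferentiableAt_totalSpace]
    refine ⟨h0.1.comp t₀ (f := fun t : ℝ => (t, s₀)) (by
      rw [mdifferentiableAt_iff_differentiableAt]; fun_prop), ?_⟩
    rw [mdifferentiableAt_iff_differentiableAt]
    refine DifferentiableAt.congr_of_eventuallyEq g3.differentiableAt ?_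
    filter_upwards [key] with t ht
    have := congrArg Prod.snd ht
    simp only [Function.comp, ModelWithCorners.tangent, FiberBundle.extChartAt] at this
    exact this
  rw [velocity_eq _ _ _ hV, key.fderiv_eq, hVt]
  have g4 := (g2.prodMk g3).fderiv
  simp only [Function.comp_def] at g4
  rw [g4]
  simp

/-- The defining property of the canonical involution: `∂ₜ ∂ₛ c = κ ∘ ∂ₛ ∂ₜ c`. -/
theorem canonicalInvolution_mixed (c : ℝ × ℝ → N) (t₀ s₀ : ℝ)
    (hc : ContMDiffAt 𝓘(ℝ, ℝ × ℝ) I ∞ c (t₀, s₀)) :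
    velocity I.tangent (fun t => velocity I (fun s => c (t, s)) s₀) t₀ =
      canonicalInvolution I
        (velocity I.tangent (fun s => velocity I (fun t => c (t, s)) t₀) s₀) := by
  set σ : (ℝ × ℝ) ≃L[ℝ] (ℝ × ℝ) := ContinuousLinearEquiv.prodComm ℝ ℝ ℝ
  set f : ℝ × ℝ → E := extChartAt I (c (t₀, s₀)) ∘ c with hf
  have hfs : ContDiffAt ℝ ∞ f (t₀, s₀) := by
    rw [← contMDiffAt_iff_contDiffAt]
    exact (contMDiffAt_extChartAt (I := I) (n := ∞)).comp (t₀, s₀) hc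
  have hc' : ContMDiffAt 𝓘(ℝ, ℝ × ℝ) I ∞ (c ∘ σ) (s₀, t₀) :=
    ContMDiffAt.comp (s₀, t₀) (by exact hc) (contMDiffAt_iff_contDiffAt.2 σ.contDiff.contDiffAt)
  have hs := hfs.isSymmSndFDerivAt (by simpa [minSmoothness_of_isRCLikeNormedField] using ENat.LEInfty.out)
  have e2 := second_velocity I (c ∘ σ) s₀ t₀ hc'
  have hcomp : extChartAt I (c (t₀, s₀)) ∘ c ∘ σ = f ∘ σ := rfl
  have hcσ : (c ∘ σ) (s₀, t₀) = c (t₀, s₀) := rfl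
  rw [hcσ, hcomp] at e2
  have hd : fderiv ℝ (f ∘ σ) = fun p => (fderiv ℝ f (σ p)).comp (σ : ℝ × ℝ →L[ℝ] ℝ × ℝ) := by
    funext p; exact σ.comp_right_fderiv
  have hdf : DifferentiableAt ℝ (fderiv ℝ f) (t₀, s₀) :=
    (((hfs.of_le (m := 2) ENat.LEInfty.out).fderiv_right (m := 1) (by norm_num)).differentiableAt one_ne_zero)
  have h2 : fderiv ℝ (fderiv ℝ (f ∘ σ)) (s₀, t₀) (1, 0) (0, 1) =
      fderiv ℝ (fderiv ℝ f) (t₀, s₀) (0, 1) (1, 0) := by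
    rw [hd]
    have a : HasFDerivAt (fun p => fderiv ℝ f (σ p)) _ (s₀, t₀) :=
      HasFDerivAt.comp (s₀, t₀) (g := fderiv ℝ f) (f := σ) (by exact hdf.hasFDerivAt) σ.hasFDerivAt
    have := (a.clm_comp (hasFDerivAt_const (σ : ℝ × ℝ →L[ℝ] ℝ × ℝ) (s₀, t₀))).fderiv
    rw [this]
    simp
    rfl
  rw [second_velocity I c t₀ s₀ hc]
  erw [e2]
  rw [h2, hd]
  have := hs (1, 0) (0, 1)
  rw [this]
  rfl

/-- The Liouville vector field is `E ξ = ∂ₛ ((1 + s) ξ)` at `s = 0`. -/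
theorem velocity_smul_eq_liouville (ξ : TangentBundle I N) :
    velocity I.tangent
      (fun s : ℝ => (⟨ξ.proj, (1 + s) • ξ.snd⟩ : TangentBundle I N)) 0 = ⟨ξ, liouville I N ξ⟩ := by
  have main : ∀ (x : N) (v : E), velocity I.tangent
      (fun s : ℝ => (⟨x, ((1 + s) • v : E)⟩ : TangentBundle I N)) 0 =
        ⟨⟨x, v⟩, ((0, v) : E × E)⟩ := by
    intro x v
    have htr : ∀ s : ℝ, trivializationAt E (TangentSpace I) x
        (⟨x, ((1 + s) • v : E)⟩ : TangentBundle I N) = (x, (1 + s) • v) := by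
      intro s
      refine Prod.ext rfl ?_
      exact tangentCoordChange_self (I := I) (mem_extChartAt_source (I := I) x)
    have hder : HasFDerivAt (fun s : ℝ => (extChartAt I x x, (1 + s) • v))
        ((0 : ℝ →L[ℝ] E).prod ((ContinuousLinearMap.id ℝ ℝ).smulRight v)) 0 := by
      refine (hasFDerivAt_const _ _).prodMk ?_
      exact ((hasFDerivAt_id (0 : ℝ)).const_add 1).smul_const v
    have hV : MDifferentiableAt 𝓘(ℝ, ℝ) I.tangent
        (fun s : ℝ => (⟨x, ((1 + s) • v : E)⟩ : TangentBundle I N)) 0 := by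
      rw [ModelWithCorners.tangent, mdifferentiableAt_totalSpace]
      refine ⟨mdifferentiableAt_const, ?_⟩
      rw [mdifferentiableAt_iff_differentiableAt]
      simp only [htr]
      exact hder.snd.differentiableAt
    have h0 : (⟨x, ((1 + (0 : ℝ)) • v : E)⟩ : TangentBundle I N) = ⟨x, v⟩ := by
      rw [add_zero, one_smul]
    rw [velocity_eq _ _ _ hV, h0]
    have : (extChartAt I.tangent (⟨x, v⟩ : TangentBundle I N) ∘
        fun s : ℝ => (⟨x, ((1 + s) • v : E)⟩ : TangentBundle I N)) =
        fun s : ℝ => (extChartAt I x x, (1 + s) • v) := by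
      funext s
      rw [ModelWithCorners.tangent, FiberBundle.extChartAt]
      refine Prod.ext rfl ?_
      exact tangentCoordChange_self (I := I) (mem_extChartAt_source (I := I) x)
    rw [this, hder.fderiv]
    simp
  exact main ξ.proj ξ.snd

end Iterated

section Sprays

variable {E : Type*} [NormedAddCommGroup E] [NormedSpace ℝ E]
  {H : Type*} [TopologicalSpace H] (I : ModelWithCorners ℝ E H)
  (M : Type*) [TopologicalSpace M] [ChartedSpace H M] [IsManifold I ∞ M]

/-- A spray on `M`: a smooth vector field `S` on `TM ∖ 0` such that `Dπ ∘ S = id` and `[E, S] = S`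
for the Liouville vector field `E`.  The values of `toFun` outside `TM ∖ 0` are irrelevant. -/
structure Spray where
  toFun : (ξ : TangentBundle I M) → TangentSpace I.tangent ξ
  smooth : ContMDiffOn I.tangent I.tangent.tangent ∞
    (fun ξ => (⟨ξ, toFun ξ⟩ : TangentBundle I.tangent (TangentBundle I M))) (slashed I M)
  proj_eq : ∀ ξ ∈ slashed I M,
    tangentMap I.tangent I (fun η : TangentBundle I M => η.proj) ⟨ξ, toFun ξ⟩ = ξ
  homogeneous : ∀ ξ ∈ slashed I M,
    VectorField.mlieBracket I.tangent (liouville I M) toFun ξ = toFun ξ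

variable {I M}

/-- A spray as a map `TM → TTM`. -/
def Spray.toMap (S : Spray I M) (ξ : TangentBundle I M) :
    TangentBundle I.tangent (TangentBundle I M) :=
  ⟨ξ, S.toFun ξ⟩

variable (I M) in
/-- The projection `TTM → M`. -/
def projTT (ξ : TangentBundle I.tangent (TangentBundle I M)) : M := ξ.proj.proj

/-- The second complete lift `S^cc` of a spray `S`, as a map `TTTM → TTTTM`. -/
def Spray.secondLift (S : Spray I M) :
    TangentBundle I.tangent.tangent (TangentBundle I.tangent (TangentBundle I M)) →
      TangentBundle I.tangent.tangent.tangent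
        (TangentBundle I.tangent.tangent (TangentBundle I.tangent (TangentBundle I M))) :=
  completeLift I.tangent (completeLift I S.toMap)

variable (I) in
/-- Geodesics `γ : D → N` (`D` an open interval) of a vector field `S` on the slashed bundle
`{ξ ∈ TN | Dp ξ ≠ 0}`, where `p : N → M` is the projection of `N = M, TM, TTM, …` onto `M`:
`γ` is smooth and regular, i.e. `Dp ∘ γ' ≠ 0`, and `γ'' = S ∘ γ'`. -/
def IsGeodesic {E' : Type*} [NormedAddCommGroup E'] [NormedSpace ℝ E']
    {H' : Type*} [TopologicalSpace H'] (J : ModelWithCorners ℝ E' H')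
    {N : Type*} [TopologicalSpace N] [ChartedSpace H' N] [IsManifold J ∞ N]
    (p : N → M) (S : TangentBundle J N → TangentBundle J.tangent (TangentBundle J N))
    (γ : ℝ → N) (D : Set ℝ) : Prop :=
  ContMDiffOn 𝓘(ℝ, ℝ) J ∞ γ D ∧
  (∀ t ∈ D, tangentMap J I p (velocity J γ t) ∈ slashed I M) ∧
  ∀ t ∈ D, velocity J.tangent (velocity J γ) t = S (velocity J γ t)

/-- Geodesics `c : D → M` of a spray `S` on `M`. -/
def Spray.IsGeodesic (S : Spray I M) (c : ℝ → M) (D : Set ℝ) : Prop :=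
  SprayGeometry.IsGeodesic I I id S.toMap c D

/-- `J : D → TM` is a parallel Jacobi field for `S`: there are a geodesic `c : D → M` of `S` and
`α, β ∈ ℝ` with `J t = α c'(t) + β t c'(t)` for `t ∈ D`. -/
def Spray.IsParallelJacobiField (S : Spray I M) (J : ℝ → TangentBundle I M) (D : Set ℝ) : Prop :=
  ∃ (α β : ℝ) (c : ℝ → M), S.IsGeodesic c D ∧
    ∀ t ∈ D, J t = ⟨c t, α • (velocity I c t).snd + (β * t) • (velocity I c t).snd⟩

/-- The set `Δ ⊆ TTTM` of all `(κ ∘ J')'(0)`, where `J : (-ε, ε) → TM` is a parallel Jacobi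
field for `S`. -/
def Spray.phaseSpace (S : Spray I M) :
    Set (TangentBundle I.tangent.tangent (TangentBundle I.tangent (TangentBundle I M))) :=
  {η | ∃ ε > 0, ∃ J : ℝ → TangentBundle I M,
    S.IsParallelJacobiField J (Set.Ioo (-ε) ε) ∧
    η = velocity I.tangent.tangent
      (fun t => canonicalInvolution I (velocity I.tangent J t)) 0}

/-- Geodesics `γ : D → TTM` in the sub-spray `P = (S^cc, TTM, Δ)`: geodesics of `S^cc` with
`γ'(t₀) ∈ Δ` for some `t₀ ∈ D`. -/
def Spray.IsGeodesicInP (S : Spray I M)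
    (γ : ℝ → TangentBundle I.tangent (TangentBundle I M)) (D : Set ℝ) : Prop :=
  SprayGeometry.IsGeodesic I I.tangent.tangent (projTT I M) S.secondLift γ D ∧
  ∃ t₀ ∈ D, velocity I.tangent.tangent γ t₀ ∈ S.phaseSpace

end Sprays

end SprayGeometry

end

open scoped Manifold ContDiff

noncomputable section

namespace SprayGeometry

/-! ### Induced charts of the tangent bundle. -/

section Charts

variable {E : Type*} [NormedAddCommGroup E] [NormedSpace ℝ E]
  {H : Type*} [TopologicalSpace H] (I : ModelWithCorners ℝ E H)
  {N : Type*} [TopologicalSpace N] [ChartedSpace H N] [IsManifold I ∞ N]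

/-! In a chart a spray is a second order equation x'' = F(x, x'), and `SecondOrderRep.completeLift`
shows that its complete lift is the same equation together with its linearization: x'' = F(x, x'),
v'' = dF(x, x')(v, v'). The condition [E, S] = S becomes Euler's relation dF(x, y)(0, y) = 2 F(x, y)
(`Spray.fderiv_localRep`).

For a geodesic c of S, the field c' solves the linearized equation because the geodesic equation may
be differentiated, and t c' solves it because of Euler's relation. So J = (α + βt) c' is a geodesic
of S^c (`jacobi_equation`). Differentiating once more and using the symmetry of D²F, the curve κ ∘
J', with coordinates ((x, x'), (v, v')), is a geodesic of S^cc (`second_lift_equation`).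

By definition Δ consists of the velocities of such curves at 0. Uniqueness for second order
equations, continued along the interval (`eqOn_of_velocity_eq`), therefore forces a geodesic in P to
be κ ∘ J' on its whole interval, where c is its own projection to M
(`Spray.exists_eqOn_parallelLift`). A translation of the parameter, which preserves the family (α +
βt) c', handles the case where Δ is met at a parameter other than 0
(`Spray.IsGeodesicInP.exists_eqOn`).

Finally κ ∘ J' has coordinates ((x, x'), (αx', βx' + αx'')) at 0. The first pair determines c, hence
also x'' = F(x, x'), and as x' ≠ 0 the second pair determines α and then β
(`Spray.eq_of_parallelLift_eq`). So the initial point determines everything. -/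

theorem mem_extChartAt_tangent_source (q ξ : TangentBundle I N) :
    ξ ∈ (extChartAt I.tangent q).source ↔ ξ.proj ∈ (extChartAt I q.proj).source := by
  rw [extChartAt_source, extChartAt_source, TangentBundle.mem_chart_source_iff]

theorem extChartAt_tangent_fst (q ξ : TangentBundle I N) :
    (extChartAt I.tangent q ξ).1 = extChartAt I q.proj ξ.proj := rfl

theorem mem_extChartAt_tangent_target [I.Boundaryless] (q : TangentBundle I N) (z : E × E) :
    z ∈ (extChartAt I.tangent q).target ↔ z.1 ∈ (extChartAt I q.proj).target := by
  rw [extChartAt_target, extChartAt_target, ModelWithCorners.Boundaryless.range_eq_univ,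
    ModelWithCorners.Boundaryless.range_eq_univ, Set.inter_univ, Set.inter_univ]
  exact TangentBundle.mem_chart_target_iff (I := I) (I.symm z.1, z.2) q

/-- The fibre coordinate is the image of the vector under a tangent coordinate change, which the
reverse change undoes. Hence membership in the slashed bundle can be tested in any induced chart. -/
theorem snd_eq_zero_iff (q ξ : TangentBundle I N) (hξ : ξ.proj ∈ (extChartAt I q.proj).source) :
    (extChartAt I.tangent q ξ).2 = 0 ↔ ξ.snd = 0 := by
  have h : (extChartAt I.tangent q ξ).2 = tangentCoordChange I ξ.proj q.proj ξ.proj ξ.snd := rfl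
  rw [h]
  refine ⟨fun h0 => ?_, fun h0 => by rw [h0]; exact map_zero _⟩
  have h2 := tangentCoordChange_comp (I := I) (w := ξ.proj) (x := q.proj) (y := ξ.proj)
    (z := ξ.proj) (v := ξ.snd)
    ⟨⟨mem_extChartAt_source ξ.proj, hξ⟩, mem_extChartAt_source ξ.proj⟩
  rw [h0, map_zero] at h2
  exact (h2.trans (tangentCoordChange_self (I := I) (mem_extChartAt_source ξ.proj))).symm

end Charts

/-! ### Maps, tangent maps and the canonical involution in arbitrary charts. -/

section Maps

variable {E : Type*} [NormedAddCommGroup E] [NormedSpace ℝ E]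
  {H : Type*} [TopologicalSpace H] {I : ModelWithCorners ℝ E H}
  {N : Type*} [TopologicalSpace N] [ChartedSpace H N] [IsManifold I ∞ N]
  {E' : Type*} [NormedAddCommGroup E'] [NormedSpace ℝ E']
  {H' : Type*} [TopologicalSpace H'] {I' : ModelWithCorners ℝ E' H'}
  {N' : Type*} [TopologicalSpace N'] [ChartedSpace H' N'] [IsManifold I' ∞ N']

/-- Continuity of `f` need not be assumed: since nearby values stay in the chart source, `f` agrees
near `x` with the inverse chart composed with `g` and the chart. -/
theorem contMDiffAt_of_chart [I'.Boundaryless] {f : N → N'} {x p : N} {p' : N'} {g : E → E'}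
    (hx : x ∈ (extChartAt I p).source)
    (hf : ∀ᶠ y in nhds x, f y ∈ (extChartAt I' p').source ∧
      extChartAt I' p' (f y) = g (extChartAt I p y))
    (hg : ContDiffAt ℝ ∞ g (extChartAt I p x)) : ContMDiffAt I I' ∞ f x := by
  have h0 := hf.self_of_nhds
  have h1 : ContMDiffAt I 𝓘(ℝ, E) ∞ (extChartAt I p) x :=
    contMDiffAt_extChartAt' (by rwa [extChartAt_source] at hx)
  have h2 : ContMDiffAt 𝓘(ℝ, E') I' ∞ (extChartAt I' p').symm (g (extChartAt I p x)) := by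
    have ht : g (extChartAt I p x) ∈ (extChartAt I' p').target := by
      rw [← h0.2]; exact (extChartAt I' p').map_source h0.1
    exact (contMDiffOn_extChartAt_symm p').contMDiffAt ((isOpen_extChartAt_target p').mem_nhds ht)
  have h3 : ContMDiffAt I I' ∞ ((extChartAt I' p').symm ∘ g ∘ extChartAt I p) x :=
    h2.comp x ((contMDiffAt_iff_contDiffAt.2 hg).comp x h1)
  refine h3.congr_of_eventuallyEq ?_
  filter_upwards [hf] with y hy
  simp only [Function.comp]
  rw [← hy.2, PartialEquiv.left_inv _ hy.1]

/-- A curve that is smooth in a chart is smooth. -/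
theorem contMDiffAt_curve_of_chart {F : Type*} [NormedAddCommGroup F] [NormedSpace ℝ F]
    [I'.Boundaryless] {f : F → N'} {t : F} {p' : N'} {g : F → E'}
    (hf : ∀ᶠ s in nhds t, f s ∈ (extChartAt I' p').source ∧ extChartAt I' p' (f s) = g s)
    (hg : ContDiffAt ℝ ∞ g t) : ContMDiffAt 𝓘(ℝ, F) I' ∞ f t :=
  contMDiffAt_of_chart (I := 𝓘(ℝ, F)) (p := t) (by simp)
    (by exact hf) (by exact hg)

theorem contDiffAt_extChartAt_comp {F : Type*} [NormedAddCommGroup F] [NormedSpace ℝ F]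
    {f : F → N'} {t : F} {p' : N'}
    (hf : ContMDiffAt 𝓘(ℝ, F) I' ∞ f t) (ht : f t ∈ (extChartAt I' p').source) :
    ContDiffAt ℝ ∞ (extChartAt I' p' ∘ f) t := by
  rw [← contMDiffAt_iff_contDiffAt]
  exact (contMDiffAt_extChartAt' (by rwa [extChartAt_source] at ht)).comp t hf

omit [IsManifold I' ∞ N'] in
theorem eventually_mem_source {F : Type*} [TopologicalSpace F]
    {f : F → N'} {t : F} {p' : N'}
    (hf : ContinuousAt f t) (ht : f t ∈ (extChartAt I' p').source) :
    ∀ᶠ s in nhds t, f s ∈ (extChartAt I' p').source :=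
  hf.preimage_mem_nhds ((isOpen_extChartAt_source p').mem_nhds ht)

theorem chart_velocity' (q : TangentBundle I N) {γ : ℝ → N} {t : ℝ}
    (hγ : ContMDiffAt 𝓘(ℝ, ℝ) I ∞ γ t) (hs : γ t ∈ (extChartAt I q.proj).source) :
    extChartAt I.tangent q (velocity I γ t) =
      (extChartAt I q.proj (γ t), deriv (extChartAt I q.proj ∘ γ) t) := by
  rw [chart_velocity I q γ t (hγ.mdifferentiableAt (by simp)) (by rwa [extChartAt_source] at hs),
    fderiv_apply_one_eq_deriv]

omit [IsManifold I ∞ N] [IsManifold I' ∞ N'] in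
theorem tangentMap_velocity {f : N → N'} {γ : ℝ → N} {t : ℝ}
    (hf : MDifferentiableAt I I' f (γ t)) (hγ : MDifferentiableAt 𝓘(ℝ, ℝ) I γ t) :
    tangentMap I I' f (velocity I γ t) = velocity I' (f ∘ γ) t := by
  unfold velocity tangentMap
  rw [mfderiv_comp t hf hγ]
  rfl

/-- The curve is a straight line in the chart. Its coordinate formula is part of the conclusion
because tangent maps are computed below by testing them on such curves. -/
theorem exists_velocity_eq [I.Boundaryless] (ξ : TangentBundle I N) (p : TangentBundle I N)
    (hξ : ξ.proj ∈ (extChartAt I p.proj).source) :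
    ∃ γ : ℝ → N, ContMDiffAt 𝓘(ℝ, ℝ) I ∞ γ 0 ∧ γ 0 = ξ.proj ∧ velocity I γ 0 = ξ ∧
      (∀ᶠ s in nhds (0 : ℝ), γ s ∈ (extChartAt I p.proj).source ∧
      extChartAt I p.proj (γ s) =
        (extChartAt I.tangent p ξ).1 + s • (extChartAt I.tangent p ξ).2) := by
  set x := (extChartAt I.tangent p ξ).1 with hx
  set y := (extChartAt I.tangent p ξ).2 with hy
  have hxt : x ∈ (extChartAt I p.proj).target := by
    rw [hx, extChartAt_tangent_fst]; exact (extChartAt I p.proj).map_source hξ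
  have hcont : ContDiff ℝ ∞ (fun s : ℝ => x + s • y) := by fun_prop
  set γ : ℝ → N := fun s => (extChartAt I p.proj).symm (x + s • y) with hγ
  have hev : ∀ᶠ s in nhds (0 : ℝ), γ s ∈ (extChartAt I p.proj).source ∧
      extChartAt I p.proj (γ s) = x + s • y := by
    have : ∀ᶠ s in nhds (0 : ℝ), x + s • y ∈ (extChartAt I p.proj).target :=
      hcont.continuous.continuousAt.preimage_mem_nhds
        ((isOpen_extChartAt_target p.proj).mem_nhds (by simpa using hxt))
    filter_upwards [this] with s hs
    exact ⟨(extChartAt I p.proj).map_target hs, (extChartAt I p.proj).right_inv hs⟩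
  have hsm := contMDiffAt_curve_of_chart hev hcont.contDiffAt
  have h0 : γ 0 = ξ.proj := by
    simp only [hγ, zero_smul, add_zero, hx, extChartAt_tangent_fst]
    exact (extChartAt I p.proj).left_inv hξ
  refine ⟨γ, hsm, h0, ?_, hev⟩
  apply (extChartAt I.tangent p).injOn
  · rw [mem_extChartAt_tangent_source]; exact hev.self_of_nhds.1
  · rw [mem_extChartAt_tangent_source]; exact hξ
  · rw [chart_velocity' p hsm hev.self_of_nhds.1]
    refine Prod.ext ?_ ?_
    · simp only; rw [h0]; rfl
    · have : (extChartAt I p.proj ∘ γ) =ᶠ[nhds 0] fun s => x + s • y := by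
        filter_upwards [hev] with s hs using hs.2
      simp only [this.deriv_eq]
      have := ((hasDerivAt_id (0:ℝ)).smul_const y).const_add x
      rw [one_smul] at this
      exact this.deriv

/-- Represent `ξ` as the velocity of a coordinate line; its image has velocity `tangentMap I I' f
ξ`, and the chart expression of that image is `g` along the line. -/
theorem chart_tangentMap [I.Boundaryless] {f : N → N'} (ξ p : TangentBundle I N)
    (p' : TangentBundle I' N') {g : E → E'}
    (hξ : ξ.proj ∈ (extChartAt I p.proj).source)
    (hf : ContMDiffAt I I' ∞ f ξ.proj)
    (hp' : f ξ.proj ∈ (extChartAt I' p'.proj).source)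
    (hfg : ∀ᶠ y in nhds ξ.proj, extChartAt I' p'.proj (f y) = g (extChartAt I p.proj y))
    (hg : DifferentiableAt ℝ g (extChartAt I.tangent p ξ).1) :
    extChartAt I'.tangent p' (tangentMap I I' f ξ) =
      (g (extChartAt I.tangent p ξ).1,
        fderiv ℝ g (extChartAt I.tangent p ξ).1 (extChartAt I.tangent p ξ).2) := by
  obtain ⟨γ, hγ, h0, hv, hev⟩ := exists_velocity_eq ξ p hξ
  have hfγ : ContMDiffAt 𝓘(ℝ, ℝ) I' ∞ (f ∘ γ) 0 := ContMDiffAt.comp 0 (by rwa [h0]) hγ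
  have h1 := tangentMap_velocity (f := f) (by rw [h0]; exact hf.mdifferentiableAt (by simp))
    (hγ.mdifferentiableAt (by simp))
  rw [hv] at h1
  rw [h1, chart_velocity' p' hfγ (by simpa [h0] using hp')]
  have e : (extChartAt I' p'.proj ∘ f ∘ γ) =ᶠ[nhds 0]
      fun s => g ((extChartAt I.tangent p ξ).1 + s • (extChartAt I.tangent p ξ).2) := by
    have hc : ContinuousAt γ 0 := hγ.continuousAt
    unfold ContinuousAt at hc
    rw [h0] at hc
    filter_upwards [hev, hc.eventually hfg] with s hs hs'
    simp only [Function.comp]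
    rw [hs', hs.2]
  refine Prod.ext ?_ ?_
  · have := e.self_of_nhds
    simpa using this
  · simp only [e.deriv_eq]
    have h2 : HasDerivAt (fun s : ℝ => (extChartAt I.tangent p ξ).1 +
        s • (extChartAt I.tangent p ξ).2) (extChartAt I.tangent p ξ).2 0 := by
      simpa using ((hasDerivAt_id (0:ℝ)).smul_const (extChartAt I.tangent p ξ).2).const_add
        (extChartAt I.tangent p ξ).1
    have h3 : HasFDerivAt g (fderiv ℝ g (extChartAt I.tangent p ξ).1)
        ((extChartAt I.tangent p ξ).1 + (0:ℝ) • (extChartAt I.tangent p ξ).2) := by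
      simpa using hg.hasFDerivAt
    exact (h3.comp_hasDerivAt 0 h2).deriv

/-- The definition of the involution uses the preferred chart at the point itself, so its form in
another chart needs an argument. Every `ξ` is a mixed velocity of a two-parameter map, and
`canonicalInvolution_mixed` makes the involution exchange the two orders of differentiation, a
description free of charts. -/
theorem canonicalInvolution_chart [I.Boundaryless] (p : N)
    (ξ q : TangentBundle I.tangent (TangentBundle I N)) (hq : q.proj.proj = p)
    (hξ : ξ.proj.proj ∈ (extChartAt I p).source) :
    extChartAt I.tangent.tangent q (canonicalInvolution I ξ) =
      (((extChartAt I.tangent.tangent q ξ).1.1, (extChartAt I.tangent.tangent q ξ).2.1),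
       ((extChartAt I.tangent.tangent q ξ).1.2, (extChartAt I.tangent.tangent q ξ).2.2)) := by
  subst hq
  rcases h : extChartAt I.tangent.tangent q ξ with ⟨⟨x, y⟩, ⟨X, Y⟩⟩
  have hx : x = extChartAt I q.proj.proj ξ.proj.proj := by
    have : x = ((extChartAt I.tangent.tangent q ξ).1).1 := by rw [h]
    rw [this]; rfl
  have hxt : x ∈ (extChartAt I q.proj.proj).target := by
    rw [hx]; exact (extChartAt I q.proj.proj).map_source hξ
  -- The polynomial whose value, s-derivative, t-derivative and mixed derivative at the origin are
  -- x, y, X and Y.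
  set f : ℝ × ℝ → E := fun z => x + z.2 • y + z.1 • X + (z.1 * z.2) • Y with hf
  have hfs : ContDiff ℝ ∞ f := by fun_prop
  set c : ℝ × ℝ → N := fun z => (extChartAt I q.proj.proj).symm (f z) with hc
  have hf0 : f (0, 0) = x := by simp [f]
  have hev : ∀ᶠ z in nhds ((0 : ℝ), (0 : ℝ)), f z ∈ (extChartAt I q.proj.proj).target :=
    hfs.continuous.continuousAt.preimage_mem_nhds
      ((isOpen_extChartAt_target q.proj.proj).mem_nhds (by rwa [hf0]))
  have hcs : ∀ᶠ z in nhds ((0 : ℝ), (0 : ℝ)), ContMDiffAt 𝓘(ℝ, ℝ × ℝ) I ∞ c z ∧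
      c z ∈ (extChartAt I q.proj.proj).source ∧ extChartAt I q.proj.proj (c z) = f z := by
    filter_upwards [eventually_eventually_nhds.2 hev] with z hz
    have : ∀ᶠ w in nhds z, c w ∈ (extChartAt I q.proj.proj).source ∧
        extChartAt I q.proj.proj (c w) = f w := by
      filter_upwards [hz] with w hw
      exact ⟨(extChartAt I q.proj.proj).map_target hw, (extChartAt I q.proj.proj).right_inv hw⟩
    exact ⟨contMDiffAt_curve_of_chart this hfs.contDiffAt, this.self_of_nhds⟩
  have hd1 : ∀ t, HasDerivAt (fun s => f (t, s)) (y + t • Y) 0 := by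
    intro t
    have h1 := ((((hasDerivAt_id (0:ℝ)).smul_const y).const_add x).add_const (t • X)).add
      (((hasDerivAt_id (0:ℝ)).const_mul t).smul_const Y)
    exact h1.congr_deriv (by simp)
  have hd2 : ∀ s, HasDerivAt (fun t => f (t, s)) (X + s • Y) 0 := by
    intro s
    have h1 := ((((hasDerivAt_id (0:ℝ)).smul_const X).const_add (x + s • y))).add
      (((hasDerivAt_id (0:ℝ)).mul_const s).smul_const Y)
    exact h1.congr_deriv (by simp)
  have hi1 : Filter.Tendsto (fun s : ℝ => ((0 : ℝ), s)) (nhds 0) (nhds (0, 0)) :=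
    Continuous.tendsto (by fun_prop) 0
  have hi2 : Filter.Tendsto (fun s : ℝ => (s, (0 : ℝ))) (nhds 0) (nhds (0, 0)) :=
    Continuous.tendsto (by fun_prop) 0
  have sl1 : ∀ t s, ContMDiffAt 𝓘(ℝ, ℝ × ℝ) I ∞ c (t, s) →
      ContMDiffAt 𝓘(ℝ, ℝ) I ∞ (fun s => c (t, s)) s := fun t s h =>
    ContMDiffAt.comp (f := fun s : ℝ => (t, s)) s h
      (contMDiffAt_iff_contDiffAt.2 (by fun_prop))
  have sl2 : ∀ t s, ContMDiffAt 𝓘(ℝ, ℝ × ℝ) I ∞ c (t, s) →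
      ContMDiffAt 𝓘(ℝ, ℝ) I ∞ (fun t => c (t, s)) t := fun t s h =>
    ContMDiffAt.comp (f := fun t : ℝ => (t, s)) t h
      (contMDiffAt_iff_contDiffAt.2 (by fun_prop))
  have v1 : ∀ᶠ t in nhds (0 : ℝ), extChartAt I.tangent q.proj (velocity I (fun s => c (t, s)) 0) =
      (f (t, 0), y + t • Y) := by
    filter_upwards [hi2.eventually (eventually_eventually_nhds.2 hcs)] with t ht
    rw [chart_velocity' q.proj (sl1 t 0 ht.self_of_nhds.1) ht.self_of_nhds.2.1]
    refine Prod.ext ht.self_of_nhds.2.2 ?_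
    refine (HasDerivAt.congr_of_eventuallyEq (hd1 t) ?_).deriv
    have : Filter.Tendsto (fun s : ℝ => (t, s)) (nhds 0) (nhds (t, 0)) :=
      Continuous.tendsto (by fun_prop) 0
    filter_upwards [this.eventually ht] with s hs using hs.2.2
  have v2 : ∀ᶠ s in nhds (0 : ℝ), extChartAt I.tangent q.proj (velocity I (fun t => c (t, s)) 0) =
      (f (0, s), X + s • Y) := by
    filter_upwards [hi1.eventually (eventually_eventually_nhds.2 hcs)] with s hs
    rw [chart_velocity' q.proj (sl2 0 s hs.self_of_nhds.1) hs.self_of_nhds.2.1]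
    refine Prod.ext hs.self_of_nhds.2.2 ?_
    refine (HasDerivAt.congr_of_eventuallyEq (hd2 s) ?_).deriv
    have : Filter.Tendsto (fun t : ℝ => (t, s)) (nhds 0) (nhds (0, s)) :=
      Continuous.tendsto (by fun_prop) 0
    filter_upwards [this.eventually hs] with t ht using ht.2.2
  have w : ∀ {γ : ℝ → TangentBundle I N} {a : ℝ → E} {b : ℝ → E} {a' b' : E},
      (∀ᶠ t in nhds (0 : ℝ), (γ t).proj ∈ (extChartAt I q.proj.proj).source) →
      (∀ᶠ t in nhds (0 : ℝ), extChartAt I.tangent q.proj (γ t) = (a t, b t)) →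
      ContDiff ℝ ∞ a → ContDiff ℝ ∞ b → HasDerivAt a a' 0 → HasDerivAt b b' 0 →
      extChartAt I.tangent.tangent q (velocity I.tangent γ 0) = ((a 0, b 0), (a', b')) := by
    intro γ a b a' b' h1 h2 ha hb ha' hb'
    have hs : ContMDiffAt 𝓘(ℝ, ℝ) I.tangent ∞ γ 0 :=
      contMDiffAt_curve_of_chart (p' := q.proj) (g := fun t => (a t, b t))
        (by filter_upwards [h1, h2] with t h1 h2
            exact ⟨(mem_extChartAt_tangent_source I _ _).2 h1, h2⟩) (ha.prodMk hb).contDiffAt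
    rw [chart_velocity' q hs ((mem_extChartAt_tangent_source I _ _).2 h1.self_of_nhds)]
    refine Prod.ext h2.self_of_nhds ?_
    exact ((ha'.prodMk hb').congr_of_eventuallyEq h2).deriv
  have e1 := w (γ := fun t => velocity I (fun s => c (t, s)) 0)
    (by filter_upwards [hi2.eventually hcs] with t ht using ht.2.1) v1 (by fun_prop) (by fun_prop)
    (hd2 0) (by simpa using ((hasDerivAt_id (0:ℝ)).smul_const Y).const_add y)
  have e2 := w (γ := fun s => velocity I (fun t => c (t, s)) 0)
    (by filter_upwards [hi1.eventually hcs] with s hs using hs.2.1) v2 (by fun_prop) (by fun_prop)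
    (hd1 0) (by simpa using ((hasDerivAt_id (0:ℝ)).smul_const Y).const_add X)
  simp only [hf0, zero_smul, add_zero] at e1 e2
  have hmix := canonicalInvolution_mixed I c 0 0 hcs.self_of_nhds.1
  have hsymm : canonicalInvolution I (velocity I.tangent (fun t => velocity I (fun s => c (t, s)) 0) 0)
      = velocity I.tangent (fun s => velocity I (fun t => c (t, s)) 0) 0 := by
    rw [hmix]; rfl
  have hξeq : ξ = velocity I.tangent (fun t => velocity I (fun s => c (t, s)) 0) 0 := by
    apply (extChartAt I.tangent.tangent q).injOn
    · rw [mem_extChartAt_tangent_source, mem_extChartAt_tangent_source]; exact hξ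
    · rw [mem_extChartAt_tangent_source, mem_extChartAt_tangent_source]
      exact hcs.self_of_nhds.2.1
    · rw [e1, h]
  rw [hξeq, hsymm, e2]

end Maps

/-! ### Second order equations and their complete lifts in coordinates. -/

section SecondOrder

variable {E : Type*} [NormedAddCommGroup E] [NormedSpace ℝ E]
  {H : Type*} [TopologicalSpace H] {I : ModelWithCorners ℝ E H}
  {N : Type*} [TopologicalSpace N] [ChartedSpace H N] [IsManifold I ∞ N]

variable (I) in
/-- The chart of `TN` induced by the preferred chart of `N` at `p`. -/
abbrev tangentChart (p : N) : PartialEquiv (TangentBundle I N) (E × E) :=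
  extChartAt I.tangent (⟨p, 0⟩ : TangentBundle I N)

variable (I) in
/-- The chart of `TTN` induced by the preferred chart of `N` at `p`. -/
abbrev tangentChart₂ (p : N) :
    PartialEquiv (TangentBundle I.tangent (TangentBundle I N)) ((E × E) × (E × E)) :=
  tangentChart I.tangent (⟨p, 0⟩ : TangentBundle I N)

/-- On the part of `TN` given by `W` in the chart at `p`, the map `S` is the vector field
`(x, y) ↦ (x, y, y, F (x, y))`. -/
structure SecondOrderRep (S : TangentBundle I N → TangentBundle I.tangent (TangentBundle I N))
    (p : N) (W : Set (E × E)) (F : E × E → E) : Prop where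
  isOpen : IsOpen W
  smooth : ContDiffOn ℝ ∞ F W
  proj : ∀ ξ : TangentBundle I N, ξ.proj ∈ (extChartAt I p).source →
    tangentChart I p ξ ∈ W → (S ξ).proj = ξ
  chart : ∀ ξ : TangentBundle I N, ξ.proj ∈ (extChartAt I p).source →
    tangentChart I p ξ ∈ W →
    tangentChart₂ I p (S ξ) = (tangentChart I p ξ, ((tangentChart I p ξ).2, F (tangentChart I p ξ)))

/-- The domain of the complete lift in induced coordinates. -/
def liftDomain (W : Set (E × E)) : Set ((E × E) × (E × E)) := {z | (z.1.1, z.2.1) ∈ W}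

/-- The complete lift of a second order equation in induced coordinates. -/
def liftRep (F : E × E → E) (z : (E × E) × (E × E)) : E × E :=
  (F (z.1.1, z.2.1), fderiv ℝ F (z.1.1, z.2.1) (z.1.2, z.2.2))

theorem contMDiffAt_canonicalInvolution [I.Boundaryless]
    (ξ : TangentBundle I.tangent (TangentBundle I N)) :
    ContMDiffAt I.tangent.tangent I.tangent.tangent ∞ (canonicalInvolution I (N := N)) ξ := by
  refine contMDiffAt_of_chart (p := ξ) (p' := ξ)
    (g := fun z => ((z.1.1, z.2.1), (z.1.2, z.2.2)))
    (mem_extChartAt_source ξ) ?_ (by fun_prop)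
  have : ∀ᶠ η in nhds ξ, η ∈ (extChartAt I.tangent.tangent ξ).source :=
    (isOpen_extChartAt_source ξ).mem_nhds (mem_extChartAt_source ξ)
  filter_upwards [this] with η hη
  rw [mem_extChartAt_tangent_source, mem_extChartAt_tangent_source] at hη
  refine ⟨?_, canonicalInvolution_chart ξ.proj.proj η ξ rfl hη⟩
  rw [mem_extChartAt_tangent_source, mem_extChartAt_tangent_source]
  exact hη

theorem SecondOrderRep.contMDiffAt [I.Boundaryless]
    {S : TangentBundle I N → TangentBundle I.tangent (TangentBundle I N)}
    {p : N} {W : Set (E × E)} {F : E × E → E} (h : SecondOrderRep S p W F)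
    {ξ : TangentBundle I N} (hξ : ξ.proj ∈ (extChartAt I p).source)
    (hW : tangentChart I p ξ ∈ W) :
    (∀ᶠ η in nhds ξ, η.proj ∈ (extChartAt I p).source ∧ tangentChart I p η ∈ W) ∧
    ContMDiffAt I.tangent I.tangent.tangent ∞ S ξ := by
  have hs : ξ ∈ (tangentChart I p).source := (mem_extChartAt_tangent_source I _ _).2 hξ
  have hev : ∀ᶠ η in nhds ξ, η.proj ∈ (extChartAt I p).source ∧ tangentChart I p η ∈ W := by
    have h1 : ∀ᶠ η in nhds ξ, η ∈ (tangentChart I p).source :=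
      (isOpen_extChartAt_source _).mem_nhds hs
    have h2 := (continuousAt_extChartAt' (I := I.tangent) hs).preimage_mem_nhds
      (h.isOpen.mem_nhds hW)
    filter_upwards [h1, h2] with η h1 h2
    exact ⟨(mem_extChartAt_tangent_source I _ _).1 h1, h2⟩
  refine ⟨hev, ?_⟩
  refine contMDiffAt_of_chart (I := I.tangent) (I' := I.tangent.tangent)
    (p := (⟨p, 0⟩ : TangentBundle I N))
    (p' := (⟨⟨p, 0⟩, 0⟩ : TangentBundle I.tangent (TangentBundle I N)))
    (g := fun z => (z, (z.2, F z))) hs ?_ ?_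
  · filter_upwards [hev] with η hη
    -- Chart values say nothing outside the source; the `proj` field is what places `S η` over the
    -- chart domain.
    refine ⟨?_, h.chart η hη.1 hη.2⟩
    rw [mem_extChartAt_tangent_source, mem_extChartAt_tangent_source, h.proj η hη.1 hη.2]
    exact hη.1
  · have : ContDiffAt ℝ ∞ F (tangentChart I p ξ) :=
      h.smooth.contDiffAt (h.isOpen.mem_nhds hW)
    exact contDiffAt_id.prodMk (contDiffAt_snd.prodMk this)

/-- Follow ((x, y), (X, Y)) through the four factors. The first κ gives ((x, X), (y, Y)); DS gives
(((x, X), (X, F)), ((y, Y), (Y, dF(y, Y)))); the next κ exchanges the two middle pairs; Dκ exchanges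
middle entries in base and fibre, leaving (((x, y), (X, Y)), ((X, Y), (F, dF(y, Y)))). This is again
a second order equation, so the result can be iterated. -/
theorem SecondOrderRep.completeLift [I.Boundaryless]
    {S : TangentBundle I N → TangentBundle I.tangent (TangentBundle I N)}
    {p : N} {W : Set (E × E)} {F : E × E → E} (h : SecondOrderRep S p W F) :
    SecondOrderRep (completeLift I S) (⟨p, 0⟩ : TangentBundle I N) (liftDomain W) (liftRep F) := by
  have main : ∀ ξ : TangentBundle I.tangent (TangentBundle I N),
      ξ.proj.proj ∈ (extChartAt I p).source → tangentChart₂ I p ξ ∈ liftDomain W →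
      (SprayGeometry.completeLift I S ξ).proj = ξ ∧
      tangentChart₂ I.tangent (⟨p, 0⟩ : TangentBundle I N) (SprayGeometry.completeLift I S ξ) =
        (tangentChart₂ I p ξ, ((tangentChart₂ I p ξ).2, liftRep F (tangentChart₂ I p ξ))) := by
    intro ξ hξ hW
    set η := canonicalInvolution I ξ with hη
    have hκη : canonicalInvolution I η = ξ := rfl
    have eη : tangentChart₂ I p η = (((tangentChart₂ I p ξ).1.1, (tangentChart₂ I p ξ).2.1),
       ((tangentChart₂ I p ξ).1.2, (tangentChart₂ I p ξ).2.2)) :=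
      canonicalInvolution_chart p ξ ⟨⟨p, 0⟩, 0⟩ rfl hξ
    set x := (tangentChart₂ I p ξ).1.1
    set y := (tangentChart₂ I p ξ).1.2
    set X := (tangentChart₂ I p ξ).2.1
    set Y := (tangentChart₂ I p ξ).2.2
    have exi : tangentChart₂ I p ξ = ((x, y), (X, Y)) := rfl
    have hηs : η.proj.proj ∈ (extChartAt I p).source := hξ
    have eηp : tangentChart I p η.proj = (x, X) := by
      have : (tangentChart₂ I p η).1 = tangentChart I p η.proj := rfl
      rw [← this, eη]
    have hWη : tangentChart I p η.proj ∈ W := by rw [eηp]; exact hW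
    obtain ⟨hev, hS⟩ := h.contMDiffAt hηs hWη
    have hpη := h.proj _ hηs hWη
    have hFx : HasFDerivAt F (fderiv ℝ F (x, X)) (x, X) := by
      refine ((h.smooth.contDiffAt (h.isOpen.mem_nhds hW)).differentiableAt (by simp)).hasFDerivAt
    have hG : HasFDerivAt (fun z : E × E => (z, (z.2, F z)))
        ((ContinuousLinearMap.id ℝ (E × E)).prod
          ((ContinuousLinearMap.snd ℝ E E).prod (fderiv ℝ F (x, X)))) (x, X) :=
      (hasFDerivAt_id _).prodMk (hasFDerivAt_snd.prodMk hFx)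
    have e1 : (tangentChart₂ I p η).1 = (x, X) := by rw [eη]
    have e2 : (tangentChart₂ I p η).2 = (y, Y) := by rw [eη]
    set ζ := tangentMap I.tangent I.tangent.tangent S η with hζ
    have eζ := chart_tangentMap (I := I.tangent) (I' := I.tangent.tangent) (f := S) η
      (⟨⟨p, 0⟩, 0⟩ : TangentBundle I.tangent (TangentBundle I N))
      (⟨⟨⟨p, 0⟩, 0⟩, 0⟩ : TangentBundle I.tangent.tangent
        (TangentBundle I.tangent (TangentBundle I N)))
      (g := fun z : E × E => (z, (z.2, F z)))
      ((mem_extChartAt_tangent_source I _ _).2 hηs) hS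
      (by
        rw [mem_extChartAt_tangent_source, mem_extChartAt_tangent_source, hpη]
        exact hηs)
      (by filter_upwards [hev] with z hz using h.chart z hz.1 hz.2)
      (by
        change DifferentiableAt ℝ _ (tangentChart₂ I p η).1
        rw [e1]; exact hG.differentiableAt)
    rw [← hζ] at eζ
    have e1' : (extChartAt I.tangent.tangent
      (⟨⟨p, 0⟩, 0⟩ : TangentBundle I.tangent (TangentBundle I N)) η).1 = (x, X) := e1
    have e2' : (extChartAt I.tangent.tangent
      (⟨⟨p, 0⟩, 0⟩ : TangentBundle I.tangent (TangentBundle I N)) η).2 = (y, Y) := e2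
    rw [e1', e2', hG.fderiv] at eζ
    have hζp : ζ.proj.proj = η.proj := hpη
    set θ := canonicalInvolution I.tangent ζ with hθ
    have hθp : θ.proj.proj = η.proj := hpη
    have eθ := canonicalInvolution_chart (I := I.tangent) (⟨p, 0⟩ : TangentBundle I N) ζ
      (⟨⟨⟨p, 0⟩, 0⟩, 0⟩ : TangentBundle I.tangent.tangent
        (TangentBundle I.tangent (TangentBundle I N))) rfl
      (by rw [hζp, mem_extChartAt_tangent_source]; exact hηs)
    rw [eζ, ← hθ] at eθ
    simp only [ContinuousLinearMap.prod_apply, ContinuousLinearMap.coe_id', id,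
      ContinuousLinearMap.coe_snd'] at eθ
    have hθs : θ.proj.proj.proj ∈ (extChartAt I p).source := by rw [hθp]; exact hηs
    -- The chart expression of κ is this linear map, so it is also its own derivative in the
    -- computation of Dκ.
    set L : (E × E) × (E × E) →L[ℝ] (E × E) × (E × E) :=
      ContinuousLinearMap.prod
        (((ContinuousLinearMap.fst ℝ E E).comp (ContinuousLinearMap.fst ℝ (E × E) (E × E))).prod
          ((ContinuousLinearMap.fst ℝ E E).comp (ContinuousLinearMap.snd ℝ (E × E) (E × E))))
        (((ContinuousLinearMap.snd ℝ E E).comp (ContinuousLinearMap.fst ℝ (E × E) (E × E))).prod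
          ((ContinuousLinearMap.snd ℝ E E).comp (ContinuousLinearMap.snd ℝ (E × E) (E × E))))
      with hL
    have hLa : ∀ a b c d : E, L ((a, b), (c, d)) = ((a, c), (b, d)) := fun _ _ _ _ => rfl
    have eω := chart_tangentMap (I := I.tangent.tangent) (I' := I.tangent.tangent)
      (f := canonicalInvolution I (N := N)) θ
      (⟨⟨⟨p, 0⟩, 0⟩, 0⟩ : TangentBundle I.tangent.tangent
        (TangentBundle I.tangent (TangentBundle I N)))
      (⟨⟨⟨p, 0⟩, 0⟩, 0⟩ : TangentBundle I.tangent.tangent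
        (TangentBundle I.tangent (TangentBundle I N)))
      (g := L)
      (by rw [mem_extChartAt_tangent_source, mem_extChartAt_tangent_source]; exact hθs)
      (contMDiffAt_canonicalInvolution _)
      (by rw [mem_extChartAt_tangent_source, mem_extChartAt_tangent_source]; exact hθs)
      (by
        have : ∀ᶠ z in nhds θ.proj, z ∈ (tangentChart₂ I p).source :=
          (isOpen_extChartAt_source _).mem_nhds (by
            rw [mem_extChartAt_tangent_source, mem_extChartAt_tangent_source]; exact hθs)
        filter_upwards [this] with z hz
        rw [mem_extChartAt_tangent_source, mem_extChartAt_tangent_source] at hz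
        exact canonicalInvolution_chart p z ⟨⟨p, 0⟩, 0⟩ rfl hz)
      L.differentiableAt
    rw [L.fderiv] at eω
    have eω' := eω.trans (by rw [eθ])
    simp only [hLa] at eω'
    have hfin : tangentChart₂ I.tangent (⟨p, 0⟩ : TangentBundle I N)
        (SprayGeometry.completeLift I S ξ) =
        (tangentChart₂ I p ξ, ((tangentChart₂ I p ξ).2, liftRep F (tangentChart₂ I p ξ))) := eω'
    refine ⟨?_, hfin⟩
    -- That the lift is a section is read off from the base component of the chart formula.
    apply (tangentChart₂ I p).injOn
    · rw [mem_extChartAt_tangent_source, mem_extChartAt_tangent_source]; exact hθs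
    · rw [mem_extChartAt_tangent_source, mem_extChartAt_tangent_source]; exact hξ
    · exact congrArg Prod.fst hfin
  refine ⟨?_, ?_, ?_, ?_⟩
  · exact h.isOpen.preimage (by fun_prop : Continuous fun z : (E × E) × (E × E) => (z.1.1, z.2.1))
  · intro z hz
    have hF : ContDiffAt ℝ ∞ F (z.1.1, z.2.1) := h.smooth.contDiffAt (h.isOpen.mem_nhds hz)
    have hF' : ContDiffAt ℝ ∞ (fderiv ℝ F) (z.1.1, z.2.1) := hF.fderiv_right (by simp)
    have hm : ContDiffAt ℝ ∞ (fun z : (E × E) × (E × E) => (z.1.1, z.2.1)) z := by fun_prop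
    have hm' : ContDiffAt ℝ ∞ (fun z : (E × E) × (E × E) => (z.1.2, z.2.2)) z := by fun_prop
    exact ((hF.comp z hm).prodMk ((hF'.comp z hm).clm_apply hm')).contDiffWithinAt
  · intro ξ hξ hW
    exact (main ξ ((mem_extChartAt_tangent_source I _ _).1 hξ) hW).1
  · intro ξ hξ hW
    exact (main ξ ((mem_extChartAt_tangent_source I _ _).1 hξ) hW).2

end SecondOrder

/-! ### The geodesic equation in a chart and unique continuation. -/

section Geodesics

theorem contDiffAt_deriv {E : Type*} [NormedAddCommGroup E] [NormedSpace ℝ E] {g : ℝ → E} {t : ℝ}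
    (hg : ContDiffAt ℝ ∞ g t) : ContDiffAt ℝ ∞ (deriv g) t := by
  have h : ContDiffAt ℝ ∞ (fderiv ℝ g) t := hg.fderiv_right (by simp)
  have := h.clm_apply (contDiffAt_const (c := (1 : ℝ)))
  simpa only [fderiv_apply_one_eq_deriv] using this

theorem hasDerivAt_of_contDiffAt {E : Type*} [NormedAddCommGroup E] [NormedSpace ℝ E] {g : ℝ → E}
    {t : ℝ} (hg : ContDiffAt ℝ ∞ g t) : HasDerivAt g (deriv g t) t :=
  (hg.differentiableAt (by simp)).hasDerivAt

/-- Local uniqueness for second order equations `g'' = F (g, g')`. -/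
theorem second_order_ODE_unique {E : Type*} [NormedAddCommGroup E] [NormedSpace ℝ E]
    {F : E × E → E} {g₁ g₂ : ℝ → E} {t : ℝ} (hF : ContDiffAt ℝ ∞ F (g₁ t, deriv g₁ t))
    (h₁ : ContDiffAt ℝ ∞ g₁ t) (h₂ : ContDiffAt ℝ ∞ g₂ t)
    (e₁ : ∀ᶠ s in nhds t, deriv (deriv g₁) s = F (g₁ s, deriv g₁ s))
    (e₂ : ∀ᶠ s in nhds t, deriv (deriv g₂) s = F (g₂ s, deriv g₂ s))
    (h0 : g₁ t = g₂ t) (h0' : deriv g₁ t = deriv g₂ t) : g₁ =ᶠ[nhds t] g₂ := by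
  -- Pass to the first order system for (g, g'); its right-hand side is C¹, hence Lipschitz near the
  -- initial value.
  have hG : ContDiffAt ℝ 1 (fun z : E × E => (z.2, F z)) (g₁ t, deriv g₁ t) :=
    (contDiffAt_snd.prodMk hF).of_le (by exact_mod_cast le_top)
  obtain ⟨K, U, hU, hK⟩ := hG.exists_lipschitzOnWith
  have aux : ∀ {g : ℝ → E}, ContDiffAt ℝ ∞ g t → U ∈ nhds (g t, deriv g t) →
      (∀ᶠ s in nhds t, deriv (deriv g) s = F (g s, deriv g s)) →
      ∀ᶠ s in nhds t, HasDerivAt (fun s => (g s, deriv g s))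
        ((fun z : E × E => (z.2, F z)) (g s, deriv g s)) s ∧ (g s, deriv g s) ∈ U := by
    intro g hg hUg eg
    have hc : ContinuousAt (fun s => (g s, deriv g s)) t :=
      hg.continuousAt.prodMk (contDiffAt_deriv hg).continuousAt
    have hd : ∀ᶠ s in nhds t, DifferentiableAt ℝ g s :=
      ((hg.of_le (m := 1) (by exact_mod_cast le_top)).eventually (by simp)).mono
        fun s hs => hs.differentiableAt (by simp)
    have hd' : ∀ᶠ s in nhds t, DifferentiableAt ℝ (deriv g) s :=
      (((contDiffAt_deriv hg).of_le (m := 1) (by exact_mod_cast le_top)).eventually (by simp)).mono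
        fun s hs => hs.differentiableAt (by simp)
    filter_upwards [hc.preimage_mem_nhds hUg, hd, hd', eg] with s h1 h2 h3 h4
    refine ⟨h2.hasDerivAt.prodMk ?_, h1⟩
    rw [← h4]
    exact h3.hasDerivAt
  have := ODE_solution_unique_of_eventually (v := fun _ z => (z.2, F z)) (s := fun _ => U)
    (Filter.Eventually.of_forall fun _ => hK) (aux h₁ hU e₁)
    (aux h₂ (by rwa [← h0, ← h0']) e₂) (by rw [h0, h0'])
  filter_upwards [this] with s hs using congrArg Prod.fst hs

variable {E : Type*} [NormedAddCommGroup E] [NormedSpace ℝ E]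
  {H : Type*} [TopologicalSpace H] {I : ModelWithCorners ℝ E H}
  {N : Type*} [TopologicalSpace N] [ChartedSpace H N] [IsManifold I ∞ N]

/-- Points of one fibre are separated in a chart, points of different fibres by neighbourhoods of
their base points. The Hausdorff property makes the agreement of two velocities a closed condition.
-/
theorem t2Space_tangentBundle [T2Space N] : T2Space (TangentBundle I N) := by
  refine ⟨fun ξ η hne => ?_⟩
  by_cases hp : ξ.proj = η.proj
  · have hs := mem_extChartAt_source (I := I.tangent) ξ
    have hs' : η ∈ (extChartAt I.tangent ξ).source := by
      rw [mem_extChartAt_tangent_source, ← hp]; exact mem_extChartAt_source _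
    obtain ⟨U, V, hU, hV, hξU, hηV, hd⟩ := t2_separation
      (fun h => hne ((extChartAt I.tangent ξ).injOn hs hs' h))
    have ho := isOpen_extChartAt_source (I := I.tangent) ξ
    have hc := continuousOn_extChartAt (I := I.tangent) ξ
    refine ⟨_, _, hc.isOpen_inter_preimage ho hU, hc.isOpen_inter_preimage ho hV,
      ⟨hs, hξU⟩, ⟨hs', hηV⟩, ?_⟩
    exact (hd.preimage _).mono Set.inter_subset_right Set.inter_subset_right
  · obtain ⟨U, V, hU, hV, hξU, hηV, hd⟩ := t2_separation hp
    have hc : Continuous (Bundle.TotalSpace.proj : TangentBundle I N → N) :=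
      FiberBundle.continuous_proj E (TangentSpace I)
    exact ⟨_, _, hU.preimage hc, hV.preimage hc, hξU, hηV, hd.preimage _⟩

theorem eventually_chart_velocity {γ : ℝ → N} {t : ℝ} {p : N}
    (hγ : ∀ᶠ s in nhds t, ContMDiffAt 𝓘(ℝ, ℝ) I ∞ γ s) (hp : γ t ∈ (extChartAt I p).source) :
    ∀ᶠ s in nhds t, (velocity I γ s).proj ∈ (extChartAt I p).source ∧
      tangentChart I p (velocity I γ s) =
        ((extChartAt I p ∘ γ) s, deriv (extChartAt I p ∘ γ) s) := by
  filter_upwards [hγ, eventually_mem_source hγ.self_of_nhds.continuousAt hp] with s h1 h2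
  exact ⟨h2, chart_velocity' (⟨p, 0⟩ : TangentBundle I N) h1 h2⟩

/-- Smoothness of order ∞ at a single parameter only yields neighbourhoods depending on the order,
so smoothness is required at all nearby parameters. -/
theorem contMDiffAt_velocity [I.Boundaryless] {γ : ℝ → N} {t : ℝ}
    (hγ : ∀ᶠ s in nhds t, ContMDiffAt 𝓘(ℝ, ℝ) I ∞ γ s) :
    ContMDiffAt 𝓘(ℝ, ℝ) I.tangent ∞ (velocity I γ) t := by
  have hg := contDiffAt_extChartAt_comp hγ.self_of_nhds (mem_extChartAt_source (I := I) (γ t))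
  refine contMDiffAt_curve_of_chart (p' := (⟨γ t, 0⟩ : TangentBundle I N))
    (g := fun s => ((extChartAt I (γ t) ∘ γ) s, deriv (extChartAt I (γ t) ∘ γ) s)) ?_
    (hg.prodMk (contDiffAt_deriv hg))
  filter_upwards [eventually_chart_velocity hγ (mem_extChartAt_source (I := I) (γ t))] with s hs
  exact ⟨(mem_extChartAt_tangent_source I _ _).2 hs.1, hs.2⟩

theorem chart_velocity_velocity [I.Boundaryless] {γ : ℝ → N} {t : ℝ} {p : N}
    (hγ : ∀ᶠ s in nhds t, ContMDiffAt 𝓘(ℝ, ℝ) I ∞ γ s) (hp : γ t ∈ (extChartAt I p).source) :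
    tangentChart₂ I p (velocity I.tangent (velocity I γ) t) =
      (((extChartAt I p ∘ γ) t, deriv (extChartAt I p ∘ γ) t),
        (deriv (extChartAt I p ∘ γ) t, deriv (deriv (extChartAt I p ∘ γ)) t)) := by
  have hev := eventually_chart_velocity hγ hp
  have hg := contDiffAt_extChartAt_comp hγ.self_of_nhds hp
  have h1 := chart_velocity' (I := I.tangent)
    (⟨⟨p, 0⟩, 0⟩ : TangentBundle I.tangent (TangentBundle I N)) (contMDiffAt_velocity hγ)
    ((mem_extChartAt_tangent_source I _ _).2 hp)
  refine h1.trans (Prod.ext hev.self_of_nhds.2 ?_)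
  have h2 := (hasDerivAt_of_contDiffAt hg).prodMk
    (hasDerivAt_of_contDiffAt (contDiffAt_deriv hg))
  refine (h2.congr_of_eventuallyEq ?_).deriv
  filter_upwards [hev] with s hs using hs.2

/-- The geodesic equation in a chart. -/
theorem SecondOrderRep.velocity_velocity_eq_iff [I.Boundaryless]
    {S : TangentBundle I N → TangentBundle I.tangent (TangentBundle I N)}
    {p : N} {W : Set (E × E)} {F : E × E → E} (h : SecondOrderRep S p W F)
    {γ : ℝ → N} {t : ℝ}
    (hγ : ∀ᶠ s in nhds t, ContMDiffAt 𝓘(ℝ, ℝ) I ∞ γ s) (hp : γ t ∈ (extChartAt I p).source)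
    (hW : tangentChart I p (velocity I γ t) ∈ W) :
    velocity I.tangent (velocity I γ) t = S (velocity I γ t) ↔
      deriv (deriv (extChartAt I p ∘ γ)) t =
        F ((extChartAt I p ∘ γ) t, deriv (extChartAt I p ∘ γ) t) := by
  have h1 := chart_velocity_velocity hγ hp
  have h2 := h.chart _ hp hW
  have h3 := (eventually_chart_velocity hγ hp).self_of_nhds.2
  rw [h3] at h2
  constructor
  · intro e
    rw [e, h2] at h1
    exact (congrArg (fun z => z.2.2) h1).symm
  · intro e
    apply (tangentChart₂ I p).injOn
    · rw [mem_extChartAt_tangent_source, mem_extChartAt_tangent_source]; exact hp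
    · rw [mem_extChartAt_tangent_source, mem_extChartAt_tangent_source, h.proj _ hp hW]; exact hp
    · rw [h1, h2, e]

theorem SecondOrderRep.eventuallyEq [I.Boundaryless]
    {S : TangentBundle I N → TangentBundle I.tangent (TangentBundle I N)}
    {p : N} {W : Set (E × E)} {F : E × E → E} (h : SecondOrderRep S p W F)
    {γ₁ γ₂ : ℝ → N} {t : ℝ}
    (h₁ : ∀ᶠ s in nhds t, ContMDiffAt 𝓘(ℝ, ℝ) I ∞ γ₁ s)
    (h₂ : ∀ᶠ s in nhds t, ContMDiffAt 𝓘(ℝ, ℝ) I ∞ γ₂ s)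
    (e₁ : ∀ᶠ s in nhds t, velocity I.tangent (velocity I γ₁) s = S (velocity I γ₁ s))
    (e₂ : ∀ᶠ s in nhds t, velocity I.tangent (velocity I γ₂) s = S (velocity I γ₂ s))
    (hp : γ₁ t ∈ (extChartAt I p).source)
    (hW : tangentChart I p (velocity I γ₁ t) ∈ W)
    (h0 : velocity I γ₁ t = velocity I γ₂ t) : γ₁ =ᶠ[nhds t] γ₂ := by
  have h0' : γ₁ t = γ₂ t := congrArg Bundle.TotalSpace.proj h0
  have hp' : γ₂ t ∈ (extChartAt I p).source := by rwa [← h0']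
  have aux : ∀ {γ : ℝ → N}, (∀ᶠ s in nhds t, ContMDiffAt 𝓘(ℝ, ℝ) I ∞ γ s) →
      (∀ᶠ s in nhds t, velocity I.tangent (velocity I γ) s = S (velocity I γ s)) →
      γ t ∈ (extChartAt I p).source → tangentChart I p (velocity I γ t) ∈ W →
      ∀ᶠ s in nhds t, deriv (deriv (extChartAt I p ∘ γ)) s =
        F ((extChartAt I p ∘ γ) s, deriv (extChartAt I p ∘ γ) s) := by
    intro γ hγ eγ hp hW
    have hc := (contMDiffAt_velocity hγ).continuousAt
    filter_upwards [eventually_eventually_nhds.2 hγ, eγ, hc.eventually (h.contMDiffAt hp hW).1]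
      with s h1 h2 h3
    exact (h.velocity_velocity_eq_iff h1 h3.1 h3.2).1 h2
  have hv := (eventually_chart_velocity h₁ hp).self_of_nhds.2
  have hv' := (eventually_chart_velocity h₂ hp').self_of_nhds.2
  rw [← h0, hv] at hv'
  have key := second_order_ODE_unique (h.smooth.contDiffAt (h.isOpen.mem_nhds (by rwa [hv] at hW)))
    (contDiffAt_extChartAt_comp h₁.self_of_nhds hp)
    (contDiffAt_extChartAt_comp h₂.self_of_nhds hp') (aux h₁ e₁ hp hW)
    (aux h₂ e₂ hp' (by rwa [← h0])) (congrArg Prod.fst hv') (congrArg Prod.snd hv')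
  filter_upwards [key, eventually_mem_source h₁.self_of_nhds.continuousAt hp,
    eventually_mem_source h₂.self_of_nhds.continuousAt hp'] with s hs hs1 hs2
  exact (extChartAt I p).injOn hs1 hs2 hs

omit [IsManifold I ∞ N] in
theorem velocity_congr {γ₁ γ₂ : ℝ → N} {t : ℝ} (h : γ₁ =ᶠ[nhds t] γ₂) :
    velocity I γ₁ t = velocity I γ₂ t := by
  exact congrArg₂ (fun (x : N) (v : E) => (⟨x, v⟩ : TangentBundle I N)) h.self_of_nhds
    (congrArg (fun L : ℝ →L[ℝ] E => L 1) h.mfderiv_eq)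

omit [IsManifold I ∞ N] in
theorem eventually_velocity_congr {γ₁ γ₂ : ℝ → N} {t : ℝ} (h : γ₁ =ᶠ[nhds t] γ₂) :
    velocity I γ₁ =ᶠ[nhds t] velocity I γ₂ := by
  filter_upwards [eventually_eventually_nhds.2 h] with s hs using velocity_congr hs

omit [IsManifold I ∞ N] in
theorem eventually_contMDiffAt_of_isOpen {γ : ℝ → N} {D : Set ℝ} (hD : IsOpen D)
    (hγ : ContMDiffOn 𝓘(ℝ, ℝ) I ∞ γ D) {t : ℝ} (ht : t ∈ D) :
    ∀ᶠ s in nhds t, ContMDiffAt 𝓘(ℝ, ℝ) I ∞ γ s := by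
  filter_upwards [hD.mem_nhds ht] with s hs using hγ.contMDiffAt (hD.mem_nhds hs)

/-- An open-closed argument on the set where the germs agree. A representation is needed only along
`γ₁`, since it is used only where the two velocities coincide. -/
theorem eqOn_of_velocity_eq [I.Boundaryless] [T2Space N]
    {S : TangentBundle I N → TangentBundle I.tangent (TangentBundle I N)}
    {γ₁ γ₂ : ℝ → N} {D : Set ℝ} (hD : IsOpen D) (hD' : D.OrdConnected)
    (h₁ : ContMDiffOn 𝓘(ℝ, ℝ) I ∞ γ₁ D) (h₂ : ContMDiffOn 𝓘(ℝ, ℝ) I ∞ γ₂ D)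
    (hS : ∀ t ∈ D, ∃ p W F, SecondOrderRep S p W F ∧ γ₁ t ∈ (extChartAt I p).source ∧
      tangentChart I p (velocity I γ₁ t) ∈ W)
    (e₁ : ∀ t ∈ D, velocity I.tangent (velocity I γ₁) t = S (velocity I γ₁ t))
    (e₂ : ∀ t ∈ D, velocity I.tangent (velocity I γ₂) t = S (velocity I γ₂ t))
    {t₀ : ℝ} (ht₀ : t₀ ∈ D) (h0 : velocity I γ₁ t₀ = velocity I γ₂ t₀) : Set.EqOn γ₁ γ₂ D := by
  have loc : ∀ t ∈ D, velocity I γ₁ t = velocity I γ₂ t → γ₁ =ᶠ[nhds t] γ₂ := by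
    intro t ht hv
    obtain ⟨p, W, F, hr, hp, hW⟩ := hS t ht
    exact hr.eventuallyEq (eventually_contMDiffAt_of_isOpen hD h₁ ht)
      (eventually_contMDiffAt_of_isOpen hD h₂ ht)
      (by filter_upwards [hD.mem_nhds ht] with s hs using e₁ s hs)
      (by filter_upwards [hD.mem_nhds ht] with s hs using e₂ s hs)
      hp hW hv
  have : T2Space (TangentBundle I N) := t2Space_tangentBundle
  have hsub : D ⊆ {t | γ₁ =ᶠ[nhds t] γ₂} := by
    refine hD'.isPreconnected.subset_of_closure_inter_subset ?_ ⟨t₀, ht₀, loc t₀ ht₀ h0⟩ ?_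
    · rw [isOpen_iff_mem_nhds]
      intro t ht
      exact eventually_eventually_nhds.2 ht
    · rintro t ⟨htc, ht⟩
      -- At a limit of parameters with equal germs the velocities agree by continuity, and local
      -- uniqueness restores equality of germs.
      refine loc t ht ?_
      have := mem_closure_iff_nhdsWithin_neBot.1 htc
      have c1 := (contMDiffAt_velocity (eventually_contMDiffAt_of_isOpen hD h₁ ht)).continuousAt
      have c2 := (contMDiffAt_velocity (eventually_contMDiffAt_of_isOpen hD h₂ ht)).continuousAt
      refine tendsto_nhds_unique_of_eventuallyEq (l := nhdsWithin t {t | γ₁ =ᶠ[nhds t] γ₂}) (c1.tendsto.mono_left nhdsWithin_le_nhds)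
        (c2.tendsto.mono_left nhdsWithin_le_nhds) ?_
      filter_upwards [self_mem_nhdsWithin] with s hs using velocity_congr hs
  exact fun t ht => (hsub ht).self_of_nhds

end Geodesics

/-! ### Coefficients of a spray and Euler's relation. -/

section LocalSpray

variable {E : Type*} [NormedAddCommGroup E] [NormedSpace ℝ E]
  {H : Type*} [TopologicalSpace H] {I : ModelWithCorners ℝ E H}
  {M : Type*} [TopologicalSpace M] [ChartedSpace H M] [IsManifold I ∞ M]

theorem extChartAt_tangent_snd (q ξ : TangentBundle I M)
    (hξ : ξ.proj ∈ (extChartAt I q.proj).source) :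
    (extChartAt I.tangent q ξ).2 = mfderiv I 𝓘(ℝ, E) (extChartAt I q.proj) ξ.proj ξ.snd := by
  have hs : ξ.proj ∈ (chartAt H q.proj).source := by rwa [extChartAt_source] at hξ
  have h1 := (hasMFDerivAt_extChartAt (I := I) hs).mfderiv
  rw [mfderiv_chartAt_eq_tangentCoordChange hs] at h1
  rw [h1]
  rfl

theorem extChartAt_tangent_smul (q : TangentBundle I M) (x : M) (v : TangentSpace I x) (a : ℝ) :
    extChartAt I.tangent q (⟨x, a • v⟩ : TangentBundle I M) =
      ((extChartAt I.tangent q ⟨x, v⟩).1, a • (extChartAt I.tangent q ⟨x, v⟩).2) := by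
  refine Prod.ext rfl ?_
  exact map_smul (tangentCoordChange I x q.proj x) a v

/-- `liouville` is defined through the preferred chart at `ξ`; describing it as the velocity of s ↦
(1 + s)ξ makes it computable in any chart, where fibres are scaled linearly. -/
theorem chart_liouville [I.Boundaryless] (q : TangentBundle I.tangent (TangentBundle I M))
    (ξ : TangentBundle I M) (hξ : ξ.proj ∈ (extChartAt I q.proj.proj).source) :
    extChartAt I.tangent.tangent q ⟨ξ, liouville I M ξ⟩ =
      (extChartAt I.tangent q.proj ξ, (0, (extChartAt I.tangent q.proj ξ).2)) := by
  rw [← velocity_smul_eq_liouville]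
  set w := (extChartAt I.tangent q.proj ξ).2
  set x := (extChartAt I.tangent q.proj ξ).1
  have hev : ∀ s : ℝ, extChartAt I.tangent q.proj
      (⟨ξ.proj, (1 + s) • ξ.snd⟩ : TangentBundle I M) = (x, (1 + s) • w) := fun s =>
    extChartAt_tangent_smul q.proj ξ.proj ξ.snd (1 + s)
  have hsm : ContMDiffAt 𝓘(ℝ, ℝ) I.tangent ∞
      (fun s : ℝ => (⟨ξ.proj, (1 + s) • ξ.snd⟩ : TangentBundle I M)) 0 :=
    contMDiffAt_curve_of_chart (p' := q.proj) (g := fun s => (x, (1 + s) • w))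
      (Filter.Eventually.of_forall fun s =>
        ⟨(mem_extChartAt_tangent_source I _ _).2 hξ, hev s⟩) (by fun_prop)
  rw [chart_velocity' q hsm ((mem_extChartAt_tangent_source I _ _).2 hξ)]
  refine Prod.ext ?_ ?_
  · exact (hev 0).trans (by simp [x, w])
  · have : (extChartAt I.tangent q.proj ∘
        fun s : ℝ => (⟨ξ.proj, (1 + s) • ξ.snd⟩ : TangentBundle I M)) =
        fun s => (x, (1 + s) • w) := funext hev
    simp only [this]
    have hd : HasDerivAt (fun s : ℝ => (1 + s) • w) ((1 : ℝ) • w) 0 :=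
      ((hasDerivAt_id (0 : ℝ)).const_add 1).smul_const w
    rw [one_smul] at hd
    exact ((hasDerivAt_const (0 : ℝ) x).prodMk hd).deriv

/-- The part of `TM ∖ 0` over a chart, in induced coordinates. -/
def slashedDomain (I : ModelWithCorners ℝ E H) (p : M) : Set (E × E) :=
  {z | z.1 ∈ (extChartAt I p).target ∧ z.2 ≠ 0}

omit [IsManifold I ∞ M] in
theorem isOpen_slashedDomain [I.Boundaryless] (p : M) : IsOpen (slashedDomain I p) :=
  ((isOpen_extChartAt_target (I := I) p).preimage continuous_fst).inter
    (isOpen_compl_singleton.preimage continuous_snd)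

theorem tangentChart_mem_slashedDomain {p : M} {ξ : TangentBundle I M}
    (hξ : ξ.proj ∈ (extChartAt I p).source) :
    tangentChart I p ξ ∈ slashedDomain I p ↔ ξ ∈ slashed I M := by
  have h1 := snd_eq_zero_iff I (⟨p, 0⟩ : TangentBundle I M) ξ hξ
  constructor
  · rintro ⟨-, h⟩ h0
    exact h (h1.2 h0)
  · exact fun h => ⟨(extChartAt I p).map_source hξ, fun h0 => h (h1.1 h0)⟩

/-- The coefficients of a spray in a chart. -/
def Spray.localRep (S : Spray I M) (p : M) (z : E × E) : E :=
  (tangentChart₂ I p (S.toMap ((tangentChart I p).symm z))).2.2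

theorem isOpen_slashed [I.Boundaryless] : IsOpen (slashed I M) := by
  rw [isOpen_iff_mem_nhds]
  intro ξ hξ
  have h0 := (tangentChart_mem_slashedDomain (mem_extChartAt_source (I := I) ξ.proj)).2 hξ
  have hs : ξ ∈ (tangentChart I ξ.proj).source := mem_extChartAt_source (I := I.tangent) ξ
  have h1 : ∀ᶠ η in nhds ξ, η ∈ (tangentChart I ξ.proj).source :=
      (isOpen_extChartAt_source _).mem_nhds hs
  have h2 := (continuousAt_extChartAt' (I := I.tangent) hs).preimage_mem_nhds
      ((isOpen_slashedDomain ξ.proj).mem_nhds h0)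
  filter_upwards [h1, h2] with η h1 h2
  exact (tangentChart_mem_slashedDomain ((mem_extChartAt_tangent_source I _ _).1 h1)).1 h2

theorem Spray.secondOrderRep [I.Boundaryless] (S : Spray I M) (p : M) :
    SecondOrderRep S.toMap p (slashedDomain I p) (S.localRep p) := by
  refine ⟨isOpen_slashedDomain p, ?_, fun _ _ _ => rfl, ?_⟩
  · intro z hz
    refine ContDiffAt.contDiffWithinAt ?_
    have hzt : z ∈ (tangentChart I p).target := (mem_extChartAt_tangent_target I _ _).2 hz.1
    have hsrc := (tangentChart I p).map_target hzt
    have hsl : (tangentChart I p).symm z ∈ slashed I M := by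
      rw [← tangentChart_mem_slashedDomain ((mem_extChartAt_tangent_source I _ _).1 hsrc),
        PartialEquiv.right_inv _ hzt]
      exact hz
    have h1 : ContMDiffAt 𝓘(ℝ, E × E) I.tangent ∞ (tangentChart I p).symm z :=
      (contMDiffOn_extChartAt_symm (⟨p, 0⟩ : TangentBundle I M)).contMDiffAt
        ((isOpen_extChartAt_target _).mem_nhds hzt)
    have h2 : ContMDiffAt I.tangent I.tangent.tangent ∞ S.toMap ((tangentChart I p).symm z) :=
      S.smooth.contMDiffAt (isOpen_slashed.mem_nhds hsl)
    have h3 : ContMDiffAt I.tangent.tangent 𝓘(ℝ, (E × E) × (E × E)) ∞ (tangentChart₂ I p)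
        (S.toMap ((tangentChart I p).symm z)) := by
      refine contMDiffAt_extChartAt' ?_
      rw [← extChartAt_source I.tangent.tangent, mem_extChartAt_tangent_source]
      exact hsrc
    have h4 := contMDiffAt_iff_contDiffAt.1 (h3.comp z (h2.comp z h1))
    exact (contDiff_snd.comp contDiff_snd).contDiffAt.comp z h4
  · intro ξ hξ hW
    have hs := (mem_extChartAt_tangent_source I (⟨p, 0⟩ : TangentBundle I M) ξ).2 hξ
    have hsl := (tangentChart_mem_slashedDomain hξ).1 hW
    refine Prod.ext rfl (Prod.ext ?_ ?_)
    · have h1 := chart_tangentMap (I := I.tangent) (I' := I)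
        (f := fun η : TangentBundle I M => η.proj) (S.toMap ξ)
        (⟨⟨p, 0⟩, 0⟩ : TangentBundle I.tangent (TangentBundle I M)) (⟨p, 0⟩ : TangentBundle I M)
        (g := Prod.fst) hs
        (Bundle.contMDiff_proj (TangentSpace I)).contMDiffAt hξ
        (Filter.Eventually.of_forall fun _ => rfl) differentiableAt_fst
      have h2 : tangentMap I.tangent I (fun η : TangentBundle I M => η.proj) (S.toMap ξ) = ξ :=
        S.proj_eq ξ hsl
      rw [h2, fderiv_fst] at h1
      exact (congrArg Prod.snd h1).symm
    · change _ = (tangentChart₂ I p (S.toMap ((tangentChart I p).symm (tangentChart I p ξ)))).2.2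
      rw [PartialEquiv.left_inv _ hs]

/-- The derivative of the chart inverts that of the inverse chart, so pulling back a vector field
yields its coordinate expression. -/
theorem mpullbackWithin_extChartAt_symm [I.Boundaryless] (V : (x : M) → TangentSpace I x) (p : M)
    {z : E} (hz : z ∈ (extChartAt I p).target) :
    VectorField.mpullbackWithin 𝓘(ℝ, E) I (extChartAt I p).symm V (Set.range I) z =
      (tangentChart I p ⟨(extChartAt I p).symm z, V ((extChartAt I p).symm z)⟩).2 := by
  rw [VectorField.mpullbackWithin_apply, extChartAt_tangent_snd]
  · rw [ContinuousLinearMap.inverse_eq (mfderivWithin_extChartAt_symm_comp_mfderiv_extChartAt hz)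
      (mfderiv_extChartAt_comp_mfderivWithin_extChartAt_symm hz)]
    rfl
  · exact (extChartAt I p).map_target hz

/-- Euler's relation for the coefficients of a spray. -/
theorem Spray.fderiv_localRep [I.Boundaryless] (S : Spray I M) (ξ : TangentBundle I M)
    (hξ : ξ ∈ slashed I M) :
    fderiv ℝ (S.localRep ξ.proj) (tangentChart I ξ.proj ξ) (0, (tangentChart I ξ.proj ξ).2) =
      (2 : ℝ) • S.localRep ξ.proj (tangentChart I ξ.proj ξ) := by
  set p := ξ.proj with hp
  set z₀ := tangentChart I p ξ with hz₀
  have hps : ξ.proj ∈ (extChartAt I p).source := mem_extChartAt_source _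
  have hsrc : ξ ∈ (tangentChart I p).source := mem_extChartAt_source (I := I.tangent) ξ
  have hW : z₀ ∈ slashedDomain I p := (tangentChart_mem_slashedDomain hps).2 hξ
  have hrep := S.secondOrderRep p
  have hF : HasFDerivAt (S.localRep p) (fderiv ℝ (S.localRep p) z₀) z₀ :=
    ((hrep.smooth.contDiffAt (hrep.isOpen.mem_nhds hW)).differentiableAt (by simp)).hasFDerivAt
  have htgt : ∀ᶠ z in nhds z₀, z ∈ (tangentChart I p).target :=
    (isOpen_extChartAt_target _).mem_nhds ((tangentChart I p).map_source hsrc)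
  set V : E × E → E × E := VectorField.mpullbackWithin 𝓘(ℝ, E × E) I.tangent (tangentChart I p).symm
    (liouville I M) (Set.range I.tangent)
  set X : E × E → E × E := VectorField.mpullbackWithin 𝓘(ℝ, E × E) I.tangent (tangentChart I p).symm
    S.toFun (Set.range I.tangent)
  have hV : ∀ᶠ z in nhds z₀, V z = (0, z.2) := by
    filter_upwards [htgt] with z hz
    have hs := (mem_extChartAt_tangent_source I _ _).1 ((tangentChart I p).map_target hz)
    refine (mpullbackWithin_extChartAt_symm (I := I.tangent) (liouville I M)
      (⟨p, 0⟩ : TangentBundle I M) hz).trans ?_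
    refine (congrArg Prod.snd (chart_liouville (⟨⟨p, 0⟩, 0⟩ : TangentBundle I.tangent
      (TangentBundle I M)) _ hs)).trans ?_
    exact congrArg (fun w : E × E => ((0 : E), w.2)) ((tangentChart I p).right_inv hz)
  have hX : ∀ᶠ z in nhds z₀, X z = (z.2, S.localRep p z) := by
    filter_upwards [htgt, hrep.isOpen.mem_nhds hW] with z hz hzW
    have hs := (mem_extChartAt_tangent_source I _ _).1 ((tangentChart I p).map_target hz)
    refine (mpullbackWithin_extChartAt_symm (I := I.tangent) S.toFun
      (⟨p, 0⟩ : TangentBundle I M) hz).trans ?_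
    have := hrep.chart _ hs (by rwa [PartialEquiv.right_inv _ hz])
    rw [PartialEquiv.right_inv _ hz] at this
    exact congrArg Prod.snd this
  -- The bracket on the manifold is defined by the bracket in the preferred chart at `ξ`, which is
  -- why the chart is centred at the base point of `ξ`.
  have hbr := S.homogeneous ξ hξ
  rw [← VectorField.mlieBracketWithin_univ, VectorField.mlieBracketWithin_apply, Set.preimage_univ,
    Set.univ_inter] at hbr
  have hinv := isInvertible_mfderiv_extChartAt (I := I.tangent) (x := (⟨p, 0⟩ : TangentBundle I M))
    hsrc
  have hbr2 : VectorField.lieBracketWithin ℝ V X (Set.range I.tangent) z₀ =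
      (tangentChart₂ I p (S.toMap ξ)).2 := by
    refine Eq.trans ?_ (extChartAt_tangent_snd (I := I.tangent) (⟨⟨p, 0⟩, 0⟩ :
      TangentBundle I.tangent (TangentBundle I M)) (S.toMap ξ) hsrc).symm
    exact hinv.inverse_apply_eq.1 hbr
  rw [ModelWithCorners.Boundaryless.range_eq_univ, VectorField.lieBracketWithin_univ] at hbr2
  have h4 : VectorField.lieBracket ℝ V X z₀ = (z₀.2, S.localRep p z₀) :=
    hbr2.trans (congrArg Prod.snd (hrep.chart ξ hps hW))
  have hVd : HasFDerivAt V ((0 : E × E →L[ℝ] E).prod (ContinuousLinearMap.snd ℝ E E)) z₀ :=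
    HasFDerivAt.congr_of_eventuallyEq ((hasFDerivAt_const 0 z₀).prodMk hasFDerivAt_snd) hV
  have hXd : HasFDerivAt X ((ContinuousLinearMap.snd ℝ E E).prod (fderiv ℝ (S.localRep p) z₀)) z₀ :=
    HasFDerivAt.congr_of_eventuallyEq (hasFDerivAt_snd.prodMk hF) hX
  rw [VectorField.lieBracket_eq] at h4
  simp only [hVd.fderiv, hXd.fderiv, hV.self_of_nhds, hX.self_of_nhds] at h4
  -- With V = (0, y) and X = (y, F), the second component of DX·V − DV·X is dF(0, y) − F, and it
  -- must equal F.
  have h5 := congrArg Prod.snd h4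
  simp only [ContinuousLinearMap.prod_apply, Prod.snd_sub, ContinuousLinearMap.coe_snd'] at h5
  rw [sub_eq_iff_eq_add] at h5
  rw [h5, two_smul]

end LocalSpray

/-! ### The Jacobi equation and the second lift along a coordinate geodesic. -/

section Calculus

variable {E : Type*} [NormedAddCommGroup E] [NormedSpace ℝ E]

theorem eventually_differentiableAt {g : ℝ → E} {t : ℝ} (hg : ContDiffAt ℝ ∞ g t) :
    ∀ᶠ s in nhds t, DifferentiableAt ℝ g s :=
  ((hg.of_le (m := 1) (by exact_mod_cast le_top)).eventually (by simp)).mono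
    fun _ hs => hs.differentiableAt (by simp)

theorem deriv_prodMk_eventuallyEq {E' : Type*} [NormedAddCommGroup E'] [NormedSpace ℝ E']
    {g : ℝ → E} {v : ℝ → E'} {t : ℝ} (hg : ContDiffAt ℝ ∞ g t) (hv : ContDiffAt ℝ ∞ v t) :
    deriv (fun s => (g s, v s)) =ᶠ[nhds t] fun s => (deriv g s, deriv v s) := by
  filter_upwards [eventually_differentiableAt hg, eventually_differentiableAt hv] with s h1 h2
  exact (h1.hasDerivAt.prodMk h2.hasDerivAt).deriv

theorem deriv_deriv_prodMk {E' : Type*} [NormedAddCommGroup E'] [NormedSpace ℝ E']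
    {g : ℝ → E} {v : ℝ → E'} {t : ℝ} (hg : ContDiffAt ℝ ∞ g t) (hv : ContDiffAt ℝ ∞ v t) :
    deriv (deriv (fun s => (g s, v s))) t = (deriv (deriv g) t, deriv (deriv v) t) := by
  rw [(deriv_prodMk_eventuallyEq hg hv).deriv_eq]
  exact (deriv_prodMk_eventuallyEq (contDiffAt_deriv hg) (contDiffAt_deriv hv)).self_of_nhds

theorem deriv_linear_smul {g : ℝ → E} {t : ℝ} (hg : DifferentiableAt ℝ g t) (α β : ℝ) :
    deriv (fun s => (α + β * s) • g s) t = β • g t + (α + β * t) • deriv g t := by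
  have h : HasDerivAt (fun s : ℝ => α + β * s) β t := by
    simpa using ((hasDerivAt_id t).const_mul β).const_add α
  exact (h.smul hg.hasDerivAt).deriv.trans (add_comm _ _)

/-- In coordinates, `(α + β t) c'(t)` satisfies the Jacobi equation. -/
theorem jacobi_equation {F : E × E → E} {g : ℝ → E} {t : ℝ} (α β : ℝ)
    (hg : ContDiffAt ℝ ∞ g t) (hF : ContDiffAt ℝ ∞ F (g t, deriv g t))
    (he : ∀ᶠ s in nhds t, deriv (deriv g) s = F (g s, deriv g s))
    (hE : fderiv ℝ F (g t, deriv g t) (0, deriv g t) = (2 : ℝ) • F (g t, deriv g t)) :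
    deriv (deriv (fun s => (g s, (α + β * s) • deriv g s))) t =
      liftRep F ((g t, (α + β * t) • deriv g t),
        deriv (fun s => (g s, (α + β * s) • deriv g s)) t) := by
  have hg1 := contDiffAt_deriv hg
  have hg2 := contDiffAt_deriv hg1
  have hl : ContDiffAt ℝ ∞ (fun s : ℝ => α + β * s) t := by fun_prop
  have hv : ContDiffAt ℝ ∞ (fun s => (α + β * s) • deriv g s) t := hl.smul hg1
  have e1 : deriv (fun s => (α + β * s) • deriv g s) =ᶠ[nhds t]
      fun s => β • deriv g s + (α + β * s) • deriv (deriv g) s := by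
    filter_upwards [eventually_differentiableAt hg1] with s hs using deriv_linear_smul hs α β
  have e2 : deriv (deriv (fun s => (α + β * s) • deriv g s)) t =
      β • deriv (deriv g) t + (β • deriv (deriv g) t + (α + β * t) • deriv (deriv (deriv g)) t) := by
    rw [e1.deriv_eq, ← deriv_linear_smul (hasDerivAt_of_contDiffAt hg2).differentiableAt α β]
    have := ((hasDerivAt_of_contDiffAt hg1).const_smul β).add (hasDerivAt_of_contDiffAt
      (hl.smul hg2))
    exact this.deriv
  -- The differentiated geodesic equation: g' solves the linearized equation.
  have e3 : deriv (deriv (deriv g)) t =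
      fderiv ℝ F (g t, deriv g t) (deriv g t, deriv (deriv g) t) := by
    have h1 : deriv (deriv g) =ᶠ[nhds t] fun s => F (g s, deriv g s) := he
    rw [h1.deriv_eq]
    exact ((hF.differentiableAt (by simp)).hasFDerivAt.comp_hasDerivAt t
      ((hasDerivAt_of_contDiffAt hg).prodMk (hasDerivAt_of_contDiffAt hg1))).deriv
  rw [deriv_deriv_prodMk hg hv, (deriv_prodMk_eventuallyEq hg hv).self_of_nhds, e2]
  simp only [liftRep]
  rw [e1.self_of_nhds, e3]
  refine Prod.ext he.self_of_nhds ?_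
  -- The first summand reproduces (α + βt) g'''. By Euler's relation the second contributes 2βF =
  -- 2βg'', the remaining terms of the second derivative.
  have : ((α + β * t) • deriv g t, β • deriv g t + (α + β * t) • deriv (deriv g) t) =
      (α + β * t) • (deriv g t, deriv (deriv g) t) + β • ((0 : E), deriv g t) := by
    refine Prod.ext ?_ ?_
    · simp
    · simp [add_comm]
  simp only
  rw [this, map_add, map_smul, map_smul, hE, he.self_of_nhds]
  module

theorem fderiv_liftRep {F : E × E → E} {x y x' y' : E} (hF : ContDiffAt ℝ ∞ F (x, x'))
    (v w v' w' : E) :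
    fderiv ℝ (liftRep F) ((x, y), (x', y')) ((v, w), (v', w')) =
      (fderiv ℝ F (x, x') (v, v'),
        fderiv ℝ (fderiv ℝ F) (x, x') (v, v') (y, y') + fderiv ℝ F (x, x') (w, w')) := by
  have hF' : ContDiffAt ℝ ∞ (fderiv ℝ F) (x, x') := hF.fderiv_right (by simp)
  set L₁ : (E × E) × (E × E) →L[ℝ] E × E :=
    ((ContinuousLinearMap.fst ℝ E E).comp (ContinuousLinearMap.fst ℝ (E × E) (E × E))).prod
      ((ContinuousLinearMap.fst ℝ E E).comp (ContinuousLinearMap.snd ℝ (E × E) (E × E)))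
  set L₂ : (E × E) × (E × E) →L[ℝ] E × E :=
    ((ContinuousLinearMap.snd ℝ E E).comp (ContinuousLinearMap.fst ℝ (E × E) (E × E))).prod
      ((ContinuousLinearMap.snd ℝ E E).comp (ContinuousLinearMap.snd ℝ (E × E) (E × E)))
  have h1 : HasFDerivAt F (fderiv ℝ F (x, x')) (L₁ ((x, y), (x', y'))) :=
    (hF.differentiableAt (by simp)).hasFDerivAt
  have h2 : HasFDerivAt (fderiv ℝ F) (fderiv ℝ (fderiv ℝ F) (x, x')) (L₁ ((x, y), (x', y'))) :=
    (hF'.differentiableAt (by simp)).hasFDerivAt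
  have h3 : HasFDerivAt (liftRep F) _ ((x, y), (x', y')) :=
    (h1.comp _ L₁.hasFDerivAt).prodMk ((h2.comp _ L₁.hasFDerivAt).clm_apply L₂.hasFDerivAt)
  rw [h3.fderiv]
  refine Prod.ext ?_ ?_
  · rfl
  · simp [L₁, L₂, add_comm]

/-- In coordinates, `κ ∘ J'` is a geodesic of the second lift if `J` is one of the first lift. -/
theorem second_lift_equation {F : E × E → E} {g v : ℝ → E} {t : ℝ}
    (hg : ContDiffAt ℝ ∞ g t) (hv : ContDiffAt ℝ ∞ v t) (hF : ContDiffAt ℝ ∞ F (g t, deriv g t))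
    (he : ∀ᶠ s in nhds t, deriv (deriv g) s = F (g s, deriv g s))
    (hJ : ∀ᶠ s in nhds t, deriv (deriv v) s = fderiv ℝ F (g s, deriv g s) (v s, deriv v s)) :
    deriv (deriv (fun s => ((g s, deriv g s), (v s, deriv v s)))) t =
      liftRep (liftRep F) (((g t, deriv g t), (v t, deriv v t)),
        deriv (fun s => ((g s, deriv g s), (v s, deriv v s))) t) := by
  have hg1 := contDiffAt_deriv hg
  have hv1 := contDiffAt_deriv hv
  have hF' : ContDiffAt ℝ ∞ (fderiv ℝ F) (g t, deriv g t) := hF.fderiv_right (by simp)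
  have hgg := (hasDerivAt_of_contDiffAt hg).prodMk (hasDerivAt_of_contDiffAt hg1)
  have hvv := (hasDerivAt_of_contDiffAt hv).prodMk (hasDerivAt_of_contDiffAt hv1)
  have e3 : deriv (deriv (deriv g)) t =
      fderiv ℝ F (g t, deriv g t) (deriv g t, deriv (deriv g) t) := by
    have h1 : deriv (deriv g) =ᶠ[nhds t] fun s => F (g s, deriv g s) := he
    rw [h1.deriv_eq]
    exact ((hF.differentiableAt (by simp)).hasFDerivAt.comp_hasDerivAt t hgg).deriv
  have e4 : deriv (deriv (deriv v)) t =
      fderiv ℝ (fderiv ℝ F) (g t, deriv g t) (deriv g t, deriv (deriv g) t) (v t, deriv v t) +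
        fderiv ℝ F (g t, deriv g t) (deriv v t, deriv (deriv v) t) := by
    have h1 : deriv (deriv v) =ᶠ[nhds t]
      fun s => fderiv ℝ F (g s, deriv g s) (v s, deriv v s) := hJ
    rw [h1.deriv_eq]
    have h2 : HasDerivAt (fun s => fderiv ℝ F (g s, deriv g s))
        (fderiv ℝ (fderiv ℝ F) (g t, deriv g t) (deriv g t, deriv (deriv g) t)) t :=
      (hF'.differentiableAt (by simp)).hasFDerivAt.comp_hasDerivAt t hgg
    exact (h2.clm_apply hvv).deriv
  -- Differentiating the Jacobi equation gives D²F with (g', g'') in the first slot and (v, v') in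
  -- the second; the double lift has them in the opposite order.
  have hs := hF.isSymmSndFDerivAt
    (by simpa [minSmoothness_of_isRCLikeNormedField] using ENat.LEInfty.out)
  rw [deriv_deriv_prodMk (hg.prodMk hg1) (hv.prodMk hv1), deriv_deriv_prodMk hg hg1,
    deriv_deriv_prodMk hv hv1,
    (hgg.prodMk hvv).deriv, e3, e4, he.self_of_nhds, hJ.self_of_nhds, hs.eq]
  refine Prod.ext ?_ ?_
  · rfl
  · exact (fderiv_liftRep hF _ _ _ _).symm

end Calculus

/-! ### Projected geodesics, parallel fields and their lifts. -/

section JacobiFields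

variable {E : Type*} [NormedAddCommGroup E] [NormedSpace ℝ E]
  {H : Type*} [TopologicalSpace H] {I : ModelWithCorners ℝ E H}
  {N : Type*} [TopologicalSpace N] [ChartedSpace H N] [IsManifold I ∞ N]
  {M : Type*} [TopologicalSpace M] [ChartedSpace H M] [IsManifold I ∞ M]

theorem contMDiffAt_proj_comp {γ : ℝ → TangentBundle I N} {t : ℝ}
    (hγ : ContMDiffAt 𝓘(ℝ, ℝ) I.tangent ∞ γ t) :
    ContMDiffAt 𝓘(ℝ, ℝ) I ∞ (fun s => (γ s).proj) t :=
  (Bundle.contMDiff_proj (TangentSpace I)).contMDiffAt.comp t hγ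

theorem chart_velocity_proj {γ : ℝ → TangentBundle I N} {t : ℝ} {p : N}
    (hγ : ContMDiffAt 𝓘(ℝ, ℝ) I.tangent ∞ γ t) (hp : (γ t).proj ∈ (extChartAt I p).source) :
    tangentChart I p (velocity I (fun s => (γ s).proj) t) =
      ((tangentChart₂ I p (velocity I.tangent γ t)).1.1,
        (tangentChart₂ I p (velocity I.tangent γ t)).2.1) := by
  have hs : γ t ∈ (tangentChart I p).source := (mem_extChartAt_tangent_source I _ _).2 hp
  have h1 := chart_velocity' (⟨p, 0⟩ : TangentBundle I N) (contMDiffAt_proj_comp hγ) hp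
  have h2 := chart_velocity' (I := I.tangent)
    (⟨⟨p, 0⟩, 0⟩ : TangentBundle I.tangent (TangentBundle I N)) hγ hs
  rw [h1]
  refine Prod.ext rfl ?_
  have hg := hasDerivAt_of_contDiffAt (contDiffAt_extChartAt_comp hγ hs)
  have h3 := (hasFDerivAt_fst (𝕜 := ℝ) (p := (tangentChart I p ∘ γ) t)).comp_hasDerivAt t hg
  exact h3.deriv.trans (congrArg (fun z => z.2.1) h2).symm

/-- Geodesics of the complete lift project to geodesics. -/
theorem SecondOrderRep.velocity_velocity_proj [I.Boundaryless]
    {S : TangentBundle I N → TangentBundle I.tangent (TangentBundle I N)}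
    {p : N} {W : Set (E × E)} {F : E × E → E} (h : SecondOrderRep S p W F)
    {γ : ℝ → TangentBundle I N} {t : ℝ}
    (hγ : ∀ᶠ s in nhds t, ContMDiffAt 𝓘(ℝ, ℝ) I.tangent ∞ γ s)
    (hp : (γ t).proj ∈ (extChartAt I p).source)
    (hW : tangentChart I p (velocity I (fun s => (γ s).proj) t) ∈ W)
    (he : velocity I.tangent.tangent (velocity I.tangent γ) t =
      SprayGeometry.completeLift I S (velocity I.tangent γ t)) :
    velocity I.tangent (velocity I (fun s => (γ s).proj)) t =
      S (velocity I (fun s => (γ s).proj) t) := by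
  have hs : γ t ∈ (tangentChart I p).source := (mem_extChartAt_tangent_source I _ _).2 hp
  have hg := contDiffAt_extChartAt_comp hγ.self_of_nhds hs
  have hpr := chart_velocity_proj hγ.self_of_nhds hp
  have hW' : tangentChart₂ I p (velocity I.tangent γ t) ∈ liftDomain W := by
    rw [hpr] at hW; exact hW
  have h1 := (h.completeLift.velocity_velocity_eq_iff hγ hs hW').1 he
  rw [h.velocity_velocity_eq_iff (hγ.mono fun s hs => contMDiffAt_proj_comp hs) hp hW]
  have e : deriv (extChartAt I p ∘ fun s => (γ s).proj) =ᶠ[nhds t]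
      fun s => (deriv (tangentChart I p ∘ γ) s).1 := by
    filter_upwards [eventually_differentiableAt hg] with s hs
    exact ((hasFDerivAt_fst (𝕜 := ℝ)).comp_hasDerivAt s hs.hasDerivAt).deriv
  have h2 := (hasFDerivAt_fst (𝕜 := ℝ)
    (p := deriv (tangentChart I p ∘ γ) t)).comp_hasDerivAt t
      (hasDerivAt_of_contDiffAt (contDiffAt_deriv hg))
  rw [e.deriv_eq, e.self_of_nhds]
  exact h2.deriv.trans (congrArg Prod.fst h1)

variable (I) in
/-- The curve `t ↦ (α + β t) c'(t)` in `TN`. -/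
def parallelField (α β : ℝ) (c : ℝ → N) (t : ℝ) : TangentBundle I N :=
  ⟨c t, (α + β * t) • (velocity I c t).snd⟩

variable (I) in
/-- The curve `κ ∘ J'` in `TTN` for `J t = (α + β t) c'(t)`. -/
def parallelLift (α β : ℝ) (c : ℝ → N) (t : ℝ) : TangentBundle I.tangent (TangentBundle I N) :=
  canonicalInvolution I (velocity I.tangent (parallelField I α β c) t)

theorem eventually_chart_parallelField {α β : ℝ} {c : ℝ → N} {t : ℝ} {p : N}
    (hc : ∀ᶠ s in nhds t, ContMDiffAt 𝓘(ℝ, ℝ) I ∞ c s) (hp : c t ∈ (extChartAt I p).source) :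
    ∀ᶠ s in nhds t, parallelField I α β c s ∈ (tangentChart I p).source ∧
      tangentChart I p (parallelField I α β c s) =
        ((extChartAt I p ∘ c) s, (α + β * s) • deriv (extChartAt I p ∘ c) s) := by
  filter_upwards [eventually_chart_velocity hc hp] with s hs
  refine ⟨(mem_extChartAt_tangent_source I _ _).2 hs.1, ?_⟩
  refine (extChartAt_tangent_smul (⟨p, 0⟩ : TangentBundle I N) (c s) (velocity I c s).snd
    (α + β * s)).trans ?_
  exact congrArg (fun z : E × E => (z.1, (α + β * s) • z.2)) hs.2

theorem contMDiffAt_parallelField [I.Boundaryless] {α β : ℝ} {c : ℝ → N} {t : ℝ}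
    (hc : ∀ᶠ s in nhds t, ContMDiffAt 𝓘(ℝ, ℝ) I ∞ c s) :
    ContMDiffAt 𝓘(ℝ, ℝ) I.tangent ∞ (parallelField I α β c) t := by
  have hg := contDiffAt_extChartAt_comp hc.self_of_nhds (mem_extChartAt_source (I := I) (c t))
  refine contMDiffAt_curve_of_chart
    (eventually_chart_parallelField hc (mem_extChartAt_source (I := I) (c t))) ?_
  exact hg.prodMk (ContDiffAt.smul (by fun_prop) (contDiffAt_deriv hg))

theorem eventually_contMDiffAt_parallelField [I.Boundaryless] {α β : ℝ} {c : ℝ → N} {t : ℝ}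
    (hc : ∀ᶠ s in nhds t, ContMDiffAt 𝓘(ℝ, ℝ) I ∞ c s) :
    ∀ᶠ s in nhds t, ContMDiffAt 𝓘(ℝ, ℝ) I.tangent ∞ (parallelField I α β c) s := by
  filter_upwards [eventually_eventually_nhds.2 hc] with s hs using contMDiffAt_parallelField hs

/-- J' has coordinates ((g, v), (g', v')) with v = (α + βs) g', and κ regroups them so that the base
point in TM is the velocity of `c`. -/
theorem eventually_chart_parallelLift [I.Boundaryless] {α β : ℝ} {c : ℝ → N} {t : ℝ} {p : N}
    (hc : ∀ᶠ s in nhds t, ContMDiffAt 𝓘(ℝ, ℝ) I ∞ c s) (hp : c t ∈ (extChartAt I p).source) :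
    ∀ᶠ s in nhds t, parallelLift I α β c s ∈ (tangentChart₂ I p).source ∧
      tangentChart₂ I p (parallelLift I α β c s) =
        (((extChartAt I p ∘ c) s, deriv (extChartAt I p ∘ c) s),
          ((α + β * s) • deriv (extChartAt I p ∘ c) s,
            deriv (fun r => (α + β * r) • deriv (extChartAt I p ∘ c) r) s)) := by
  have hg := contDiffAt_extChartAt_comp hc.self_of_nhds hp
  have hv : ContDiffAt ℝ ∞ (fun r => (α + β * r) • deriv (extChartAt I p ∘ c) r) t :=
    ContDiffAt.smul (by fun_prop) (contDiffAt_deriv hg)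
  have hJ := eventually_chart_parallelField (α := α) (β := β) hc hp
  filter_upwards [eventually_contMDiffAt_parallelField (α := α) (β := β) hc,
    eventually_eventually_nhds.2 hJ, deriv_prodMk_eventuallyEq hg hv] with s h1 h2 h3
  have hs : c s ∈ (extChartAt I p).source :=
    (mem_extChartAt_tangent_source I _ _).1 h2.self_of_nhds.1
  have e : tangentChart I p ∘ parallelField I α β c =ᶠ[nhds s] fun r =>
      ((extChartAt I p ∘ c) r, (α + β * r) • deriv (extChartAt I p ∘ c) r) := by
    filter_upwards [h2] with r hr using hr.2
  have h4 := chart_velocity' (I := I.tangent)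
    (⟨⟨p, 0⟩, 0⟩ : TangentBundle I.tangent (TangentBundle I N)) h1 h2.self_of_nhds.1
  have h5 : tangentChart₂ I p (velocity I.tangent (parallelField I α β c) s) =
      (((extChartAt I p ∘ c) s, (α + β * s) • deriv (extChartAt I p ∘ c) s),
        deriv (fun r =>
          ((extChartAt I p ∘ c) r, (α + β * r) • deriv (extChartAt I p ∘ c) r)) s) :=
    h4.trans (Prod.ext h2.self_of_nhds.2 e.deriv_eq)
  rw [h3] at h5
  refine ⟨?_, ?_⟩
  · rw [mem_extChartAt_tangent_source, mem_extChartAt_tangent_source]; exact hs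
  · have h6 := canonicalInvolution_chart p (velocity I.tangent (parallelField I α β c) s)
      (⟨⟨p, 0⟩, 0⟩ : TangentBundle I.tangent (TangentBundle I N)) rfl hs
    exact h6.trans (congrArg (fun z : (E × E) × (E × E) => ((z.1.1, z.2.1), (z.1.2, z.2.2))) h5)

theorem contMDiffAt_parallelLift [I.Boundaryless] {α β : ℝ} {c : ℝ → N} {t : ℝ}
    (hc : ∀ᶠ s in nhds t, ContMDiffAt 𝓘(ℝ, ℝ) I ∞ c s) :
    ContMDiffAt 𝓘(ℝ, ℝ) I.tangent.tangent ∞ (parallelLift I α β c) t :=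
  (contMDiffAt_canonicalInvolution _).comp t
    (contMDiffAt_velocity (eventually_contMDiffAt_parallelField hc))

end JacobiFields

/-! ### Geodesics of the second lift and the phase space Δ. -/

section Phase

variable {E : Type*} [NormedAddCommGroup E] [NormedSpace ℝ E]
  {H : Type*} [TopologicalSpace H] {I : ModelWithCorners ℝ E H}
  {M : Type*} [TopologicalSpace M] [ChartedSpace H M] [IsManifold I ∞ M]

/-- `c` is a geodesic of `S` at the parameter `t`. -/
structure Spray.IsGeodesicAt (S : Spray I M) (c : ℝ → M) (t : ℝ) : Prop where
  smooth : ContMDiffAt 𝓘(ℝ, ℝ) I ∞ c t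
  regular : velocity I c t ∈ slashed I M
  equation : velocity I.tangent (velocity I c) t = S.toMap (velocity I c t)

theorem Spray.IsGeodesic.eventually {S : Spray I M} {c : ℝ → M} {D : Set ℝ}
    (h : S.IsGeodesic c D) (hD : IsOpen D) {t : ℝ} (ht : t ∈ D) :
    ∀ᶠ s in nhds t, S.IsGeodesicAt c s := by
  filter_upwards [hD.mem_nhds ht] with s hs
  refine ⟨h.1.contMDiffAt (hD.mem_nhds hs), ?_, h.2.2 s hs⟩
  have := h.2.1 s hs
  rwa [tangentMap_id] at this

theorem Spray.isGeodesic_of_forall {S : Spray I M} {c : ℝ → M} {D : Set ℝ}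
    (h : ∀ t ∈ D, S.IsGeodesicAt c t) : S.IsGeodesic c D := by
  refine ⟨fun t ht => (h t ht).smooth.contMDiffWithinAt, fun t ht => ?_, fun t ht =>
    (h t ht).equation⟩
  rw [tangentMap_id]
  exact (h t ht).regular

theorem Spray.eventually_chart_equation [I.Boundaryless] {S : Spray I M} {c : ℝ → M} {t : ℝ}
    {p : M} (h : ∀ᶠ s in nhds t, S.IsGeodesicAt c s) (hp : c t ∈ (extChartAt I p).source) :
    ∀ᶠ s in nhds t, deriv (deriv (extChartAt I p ∘ c)) s =
      S.localRep p ((extChartAt I p ∘ c) s, deriv (extChartAt I p ∘ c) s) := by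
  filter_upwards [eventually_eventually_nhds.2 h,
    eventually_mem_source h.self_of_nhds.smooth.continuousAt hp] with s h1 h2
  exact ((S.secondOrderRep p).velocity_velocity_eq_iff (h1.mono fun _ h => h.smooth) h2
    ((tangentChart_mem_slashedDomain h2).2 h1.self_of_nhds.regular)).1 h1.self_of_nhds.equation

theorem Spray.contDiffAt_localRep [I.Boundaryless] (S : Spray I M) {c : ℝ → M} {t : ℝ} {p : M}
    (h : S.IsGeodesicAt c t) (hp : c t ∈ (extChartAt I p).source) :
    ContDiffAt ℝ ∞ (S.localRep p) ((extChartAt I p ∘ c) t, deriv (extChartAt I p ∘ c) t) := by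
  have h1 := (tangentChart_mem_slashedDomain (p := p) (ξ := velocity I c t) hp).2 h.regular
  have h2 : tangentChart I p (velocity I c t) = _ :=
    chart_velocity' (⟨p, 0⟩ : TangentBundle I M) h.smooth hp
  rw [h2] at h1
  exact (S.secondOrderRep p).smooth.contDiffAt ((S.secondOrderRep p).isOpen.mem_nhds h1)

/-- Regularity in coordinates: the pair (x, X) occurring in `liftDomain` is the velocity of the
projected curve. -/
theorem Spray.velocity_mem_liftDomain {γ : ℝ → TangentBundle I M} {t : ℝ} {p : M}
    (hγ : ContMDiffAt 𝓘(ℝ, ℝ) I.tangent ∞ γ t) (hp : (γ t).proj ∈ (extChartAt I p).source)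
    (hr : velocity I (fun s => (γ s).proj) t ∈ slashed I M) :
    tangentChart₂ I p (velocity I.tangent γ t) ∈ liftDomain (slashedDomain I p) := by
  have h1 := (tangentChart_mem_slashedDomain (p := p)
    (ξ := velocity I (fun s => (γ s).proj) t) hp).2 hr
  rw [chart_velocity_proj hγ hp] at h1
  exact h1

/-- Parallel Jacobi fields are geodesics of the complete lift. -/
theorem Spray.parallelField_equation [I.Boundaryless] {S : Spray I M} {c : ℝ → M} {t : ℝ}
    (h : ∀ᶠ s in nhds t, S.IsGeodesicAt c s) (α β : ℝ) :
    velocity I.tangent.tangent (velocity I.tangent (parallelField I α β c)) t =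
      completeLift I S.toMap (velocity I.tangent (parallelField I α β c) t) := by
  have hc := h.mono fun _ h => h.smooth
  have hp : c t ∈ (extChartAt I (c t)).source := mem_extChartAt_source _
  have hJ := eventually_contMDiffAt_parallelField (α := α) (β := β) hc
  have hch := eventually_chart_parallelField (α := α) (β := β) hc hp
  have e : tangentChart I (c t) ∘ parallelField I α β c =ᶠ[nhds t] _ :=
    hch.mono fun _ h => h.2
  rw [(S.secondOrderRep (c t)).completeLift.velocity_velocity_eq_iff hJ hch.self_of_nhds.1
    (velocity_mem_liftDomain hJ.self_of_nhds hp h.self_of_nhds.regular)]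
  have e' : deriv (tangentChart I (c t) ∘ parallelField I α β c) =ᶠ[nhds t] _ := e.deriv
  rw [e'.deriv_eq, e'.self_of_nhds, e.self_of_nhds]
  refine jacobi_equation α β (contDiffAt_extChartAt_comp hc.self_of_nhds hp)
    (S.contDiffAt_localRep h.self_of_nhds hp) (eventually_chart_equation h hp) ?_
  have h2 : tangentChart I (c t) (velocity I c t) = _ :=
    chart_velocity' (⟨c t, 0⟩ : TangentBundle I M) hc.self_of_nhds hp
  -- Euler's relation is available in the chart at the base point, hence the choice of the chart at
  -- `c t`.
  have := S.fderiv_localRep (velocity I c t) h.self_of_nhds.regular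
  have h3 : (velocity I c t).proj = c t := rfl
  rw [h3, h2] at this
  exact this

theorem projTT_velocity {γ : ℝ → TangentBundle I.tangent (TangentBundle I M)} {t : ℝ}
    (hγ : ContMDiffAt 𝓘(ℝ, ℝ) I.tangent.tangent ∞ γ t) :
    tangentMap I.tangent.tangent I (projTT I M) (velocity I.tangent.tangent γ t) =
      velocity I (fun s => projTT I M (γ s)) t := by
  have h : ContMDiffAt I.tangent.tangent I ∞ (projTT I M) (γ t) :=
    (Bundle.contMDiff_proj (TangentSpace I)).contMDiffAt.comp (γ t)
      (Bundle.contMDiff_proj (TangentSpace I.tangent)).contMDiffAt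
  exact tangentMap_velocity (h.mdifferentiableAt (by simp)) (hγ.mdifferentiableAt (by simp))

theorem Spray.velocity_mem_liftDomain₂ [I.Boundaryless]
    {γ : ℝ → TangentBundle I.tangent (TangentBundle I M)} {t : ℝ} {p : M}
    (hγ : ContMDiffAt 𝓘(ℝ, ℝ) I.tangent.tangent ∞ γ t)
    (hp : projTT I M (γ t) ∈ (extChartAt I p).source)
    (hr : velocity I (fun s => projTT I M (γ s)) t ∈ slashed I M) :
    tangentChart₂ I.tangent (⟨p, 0⟩ : TangentBundle I M) (velocity I.tangent.tangent γ t) ∈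
      liftDomain (liftDomain (slashedDomain I p)) := by
  have h1 := velocity_mem_liftDomain (contMDiffAt_proj_comp hγ) hp hr
  have h2 := chart_velocity_proj (I := I.tangent) (p := (⟨p, 0⟩ : TangentBundle I M)) hγ
    ((mem_extChartAt_tangent_source I _ _).2 hp)
  have h3 : tangentChart₂ I p (velocity I.tangent (fun s => (γ s).proj) t) = _ := h2
  rw [h3] at h1
  exact h1

theorem Spray.secondLift_rep [I.Boundaryless] (S : Spray I M) (p : M) :
    SecondOrderRep S.secondLift
      (⟨⟨p, 0⟩, 0⟩ : TangentBundle I.tangent (TangentBundle I M))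
      (liftDomain (liftDomain (slashedDomain I p))) (liftRep (liftRep (S.localRep p))) :=
  (S.secondOrderRep p).completeLift.completeLift

theorem Spray.parallelLift_equation [I.Boundaryless] {S : Spray I M} {c : ℝ → M} {t : ℝ}
    (h : ∀ᶠ s in nhds t, S.IsGeodesicAt c s) (α β : ℝ) :
    velocity I.tangent.tangent.tangent (velocity I.tangent.tangent (parallelLift I α β c)) t =
      S.secondLift (velocity I.tangent.tangent (parallelLift I α β c) t) := by
  have hc := h.mono fun _ h => h.smooth
  have hp : c t ∈ (extChartAt I (c t)).source := mem_extChartAt_source _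
  have hK : ∀ᶠ s in nhds t, ContMDiffAt 𝓘(ℝ, ℝ) I.tangent.tangent ∞ (parallelLift I α β c) s := by
    filter_upwards [eventually_eventually_nhds.2 hc] with s hs using contMDiffAt_parallelLift hs
  have hch := eventually_chart_parallelLift (α := α) (β := β) hc hp
  have e : tangentChart₂ I (c t) ∘ parallelLift I α β c =ᶠ[nhds t] _ :=
    hch.mono fun _ h => h.2
  rw [(S.secondLift_rep (c t)).velocity_velocity_eq_iff hK hch.self_of_nhds.1
    (velocity_mem_liftDomain₂ hK.self_of_nhds hp h.self_of_nhds.regular)]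
  have e' : deriv (tangentChart₂ I (c t) ∘ parallelLift I α β c) =ᶠ[nhds t] _ := e.deriv
  change deriv (deriv (tangentChart₂ I (c t) ∘ parallelLift I α β c)) t = liftRep (liftRep
    (S.localRep (c t))) ((tangentChart₂ I (c t) ∘ parallelLift I α β c) t,
      deriv (tangentChart₂ I (c t) ∘ parallelLift I α β c) t)
  rw [e'.deriv_eq, e'.self_of_nhds, e.self_of_nhds]
  have hg := contDiffAt_extChartAt_comp hc.self_of_nhds hp
  refine second_lift_equation hg (ContDiffAt.smul (by fun_prop) (contDiffAt_deriv hg))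
    (S.contDiffAt_localRep h.self_of_nhds hp) (eventually_chart_equation h hp) ?_
  -- The Jacobi equation is needed at all nearby `s` in the fixed chart at `c t`, whereas its proof
  -- uses the chart at `c s`; the chart-free `parallelField_equation` mediates.
  filter_upwards [eventually_eventually_nhds.2 h,
    eventually_mem_source hc.self_of_nhds.continuousAt hp] with s h1 h2
  have hc' := h1.mono fun _ h => h.smooth
  have hJ := eventually_contMDiffAt_parallelField (α := α) (β := β) hc'
  have hch' := eventually_chart_parallelField (α := α) (β := β) hc' h2
  have e1 : tangentChart I (c t) ∘ parallelField I α β c =ᶠ[nhds s] _ :=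
    hch'.mono fun _ h => h.2
  have e1' : deriv (tangentChart I (c t) ∘ parallelField I α β c) =ᶠ[nhds s] _ := e1.deriv
  have h3 := ((S.secondOrderRep (c t)).completeLift.velocity_velocity_eq_iff hJ
    hch'.self_of_nhds.1 (velocity_mem_liftDomain hJ.self_of_nhds h2 h1.self_of_nhds.regular)).1
    (parallelField_equation h1 α β)
  rw [e1'.deriv_eq, e1'.self_of_nhds, e1.self_of_nhds] at h3
  have hg' := contDiffAt_extChartAt_comp hc'.self_of_nhds h2
  have hv' : ContDiffAt ℝ ∞ (fun r => (α + β * r) • deriv (extChartAt I (c t) ∘ c) r) s :=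
    ContDiffAt.smul (by fun_prop) (contDiffAt_deriv hg')
  rw [deriv_deriv_prodMk hg' hv', (deriv_prodMk_eventuallyEq hg' hv').self_of_nhds] at h3
  exact congrArg Prod.snd h3

theorem Spray.secondLift_eqOn [I.Boundaryless] [T2Space M] {S : Spray I M}
    {γ₁ γ₂ : ℝ → TangentBundle I.tangent (TangentBundle I M)} {D : Set ℝ}
    (hD : IsOpen D) (hD' : D.OrdConnected)
    (h₁ : SprayGeometry.IsGeodesic I I.tangent.tangent (projTT I M) S.secondLift γ₁ D)
    (h₂ : SprayGeometry.IsGeodesic I I.tangent.tangent (projTT I M) S.secondLift γ₂ D)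
    {t₀ : ℝ} (ht₀ : t₀ ∈ D)
    (h0 : velocity I.tangent.tangent γ₁ t₀ = velocity I.tangent.tangent γ₂ t₀) :
    Set.EqOn γ₁ γ₂ D := by
  have : T2Space (TangentBundle I M) := t2Space_tangentBundle
  have : T2Space (TangentBundle I.tangent (TangentBundle I M)) := t2Space_tangentBundle
  refine eqOn_of_velocity_eq hD hD' h₁.1 h₂.1 (fun t ht => ?_) h₁.2.2 h₂.2.2 ht₀ h0
  refine ⟨_, _, _, S.secondLift_rep (projTT I M (γ₁ t)), ?_, ?_⟩
  · rw [mem_extChartAt_tangent_source, mem_extChartAt_tangent_source]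
    exact mem_extChartAt_source _
  · have hs := h₁.1.contMDiffAt (hD.mem_nhds ht)
    have hr := h₁.2.1 t ht
    rw [projTT_velocity hs] at hr
    exact velocity_mem_liftDomain₂ hs (mem_extChartAt_source _) hr

theorem Spray.isGeodesic_parallelLift [I.Boundaryless] {S : Spray I M} {c : ℝ → M} {D : Set ℝ}
    (hD : IsOpen D) (h : S.IsGeodesic c D) (α β : ℝ) :
    SprayGeometry.IsGeodesic I I.tangent.tangent (projTT I M) S.secondLift
      (parallelLift I α β c) D := by
  have hs : ∀ t ∈ D, ContMDiffAt 𝓘(ℝ, ℝ) I.tangent.tangent ∞ (parallelLift I α β c) t :=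
    fun t ht => contMDiffAt_parallelLift ((h.eventually hD ht).mono fun _ h => h.smooth)
  refine ⟨fun t ht => (hs t ht).contMDiffWithinAt, fun t ht => ?_,
    fun t ht => parallelLift_equation (h.eventually hD ht) α β⟩
  rw [projTT_velocity (hs t ht)]
  exact (h.eventually hD ht).self_of_nhds.regular

/-- Geodesics of the second lift project to geodesics of the spray. -/
theorem Spray.isGeodesic_projTT [I.Boundaryless] {S : Spray I M}
    {γ : ℝ → TangentBundle I.tangent (TangentBundle I M)} {D : Set ℝ} (hD : IsOpen D)
    (h : SprayGeometry.IsGeodesic I I.tangent.tangent (projTT I M) S.secondLift γ D) :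
    S.IsGeodesic (fun t => projTT I M (γ t)) D := by
  refine isGeodesic_of_forall fun t ht => ?_
  have hev := eventually_contMDiffAt_of_isOpen hD h.1 ht
  have hev' := hev.mono fun s hs => contMDiffAt_proj_comp hs
  have hr := h.2.1 t ht
  rw [projTT_velocity hev.self_of_nhds] at hr
  set p := projTT I M (γ t) with hp
  have hps : projTT I M (γ t) ∈ (extChartAt I p).source := mem_extChartAt_source _
  -- Project twice: first to a geodesic of S^c in TM, then to one of S in M.
  have h1 := (S.secondOrderRep p).completeLift.velocity_velocity_proj hev
    ((mem_extChartAt_tangent_source I _ _).2 hps)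
    (velocity_mem_liftDomain hev'.self_of_nhds hps hr) (h.2.2 t ht)
  exact ⟨contMDiffAt_proj_comp hev'.self_of_nhds, hr,
    (S.secondOrderRep p).velocity_velocity_proj hev' hps
      ((tangentChart_mem_slashedDomain (ξ := velocity I (fun s => projTT I M (γ s)) t) hps).2 hr)
      h1⟩

omit [IsManifold I ∞ M] in
theorem parallelField_congr {α β : ℝ} {c₁ c₂ : ℝ → M} {t : ℝ} (h : c₁ =ᶠ[nhds t] c₂) :
    parallelField I α β c₁ =ᶠ[nhds t] parallelField I α β c₂ := by
  filter_upwards [eventually_velocity_congr (I := I) h] with s hs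
  exact congrArg (fun ξ : TangentBundle I M => (⟨ξ.proj, (α + β * s) • ξ.snd⟩ :
    TangentBundle I M)) hs

theorem parallelLift_congr {α β : ℝ} {c₁ c₂ : ℝ → M} {t : ℝ} (h : c₁ =ᶠ[nhds t] c₂) :
    parallelLift I α β c₁ =ᶠ[nhds t] parallelLift I α β c₂ := by
  filter_upwards [eventually_velocity_congr (I := I.tangent)
    (parallelField_congr (I := I) (α := α) (β := β) h)] with s hs
  exact congrArg (canonicalInvolution I) hs

/-- A geodesic of the second lift with initial velocity in the phase space is of the form
`κ ∘ J'` for a parallel Jacobi field `J`. -/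
theorem Spray.exists_eqOn_parallelLift [I.Boundaryless] [T2Space M] {S : Spray I M}
    {γ : ℝ → TangentBundle I.tangent (TangentBundle I M)} {D : Set ℝ}
    (hD : IsOpen D) (hD' : D.OrdConnected) (h0 : 0 ∈ D)
    (h : SprayGeometry.IsGeodesic I I.tangent.tangent (projTT I M) S.secondLift γ D)
    (hΔ : velocity I.tangent.tangent γ 0 ∈ S.phaseSpace) :
    ∃ α β : ℝ, Set.EqOn γ (parallelLift I α β fun t => projTT I M (γ t)) D := by
  obtain ⟨ε, hε, J, ⟨α, β, c, hc, hJ⟩, hγJ⟩ := hΔ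
  have h0ε : (0 : ℝ) ∈ Set.Ioo (-ε) ε := by simp [hε]
  have hJ' : J =ᶠ[nhds 0] parallelField I α β c := by
    filter_upwards [isOpen_Ioo.mem_nhds h0ε] with t ht
    rw [hJ t ht, parallelField, add_smul]
  have hv : velocity I.tangent.tangent γ 0 =
      velocity I.tangent.tangent (parallelLift I α β c) 0 := by
    rw [hγJ]
    apply velocity_congr
    filter_upwards [eventually_velocity_congr (I := I.tangent) hJ'] with t ht
    exact congrArg (canonicalInvolution I) ht
  -- The geodesic `c` supplied by Δ exists only on (-ε, ε). The comparison curve is built instead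
  -- from the projection of `γ`, a geodesic on all of `D`.
  refine ⟨α, β, secondLift_eqOn hD hD' h
    (isGeodesic_parallelLift hD (isGeodesic_projTT hD h) α β) h0 (hv.trans ?_)⟩
  have hmono : ∀ {γ : ℝ → TangentBundle I.tangent (TangentBundle I M)} {D D' : Set ℝ},
      D' ⊆ D → SprayGeometry.IsGeodesic I I.tangent.tangent (projTT I M) S.secondLift γ D →
      SprayGeometry.IsGeodesic I I.tangent.tangent (projTT I M) S.secondLift γ D' :=
    fun hs h => ⟨h.1.mono hs, fun t ht => h.2.1 t (hs ht), fun t ht => h.2.2 t (hs ht)⟩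
  -- On the common interval uniqueness gives γ = κ ∘ J'; projecting to M shows that `c` and the
  -- projection of `γ` have the same germ at 0.
  have heq := secondLift_eqOn (hD.inter isOpen_Ioo) (hD'.inter Set.ordConnected_Ioo)
    (hmono Set.inter_subset_left h)
    (hmono Set.inter_subset_right (isGeodesic_parallelLift isOpen_Ioo hc α β)) ⟨h0, h0ε⟩ hv
  apply velocity_congr
  apply parallelLift_congr
  filter_upwards [(hD.inter isOpen_Ioo).mem_nhds ⟨h0, h0ε⟩] with t ht
  exact (congrArg (projTT I M) (heq ht)).symm

end Phase

/-! ### Translation of the parameter, and recovery of a geodesic from its initial point. -/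

section Translation

variable {E : Type*} [NormedAddCommGroup E] [NormedSpace ℝ E]
  {H : Type*} [TopologicalSpace H] {I : ModelWithCorners ℝ E H}
  {N : Type*} [TopologicalSpace N] [ChartedSpace H N] [IsManifold I ∞ N]
  {M : Type*} [TopologicalSpace M] [ChartedSpace H M] [IsManifold I ∞ M]

omit [IsManifold I ∞ N] in
theorem velocity_comp_add {γ : ℝ → N} {t a : ℝ}
    (hγ : MDifferentiableAt 𝓘(ℝ, ℝ) I γ (t + a)) :
    velocity I (fun s => γ (s + a)) t = velocity I γ (t + a) := by
  have h1 : HasMFDerivAt 𝓘(ℝ, ℝ) 𝓘(ℝ, ℝ) (fun s : ℝ => s + a) t (ContinuousLinearMap.id ℝ ℝ) :=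
    ((hasFDerivAt_id t).add_const a).hasMFDerivAt
  have h2 : HasMFDerivAt 𝓘(ℝ, ℝ) I γ (t + a) (mfderiv 𝓘(ℝ, ℝ) I γ (t + a)) := hγ.hasMFDerivAt
  have h3 := (HasMFDerivAt.comp (f := fun s : ℝ => s + a) t h2 h1).mfderiv
  exact congrArg (fun L : ℝ →L[ℝ] E => (⟨γ (t + a), L 1⟩ : TangentBundle I N)) h3

omit [IsManifold I ∞ N] in
theorem eventually_velocity_comp_add {γ : ℝ → N} {t a : ℝ}
    (hγ : ∀ᶠ s in nhds (t + a), ContMDiffAt 𝓘(ℝ, ℝ) I ∞ γ s) :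
    velocity I (fun s => γ (s + a)) =ᶠ[nhds t] fun s => velocity I γ (s + a) := by
  have ht : Filter.Tendsto (fun s : ℝ => s + a) (nhds t) (nhds (t + a)) :=
    Continuous.tendsto (by fun_prop) t
  filter_upwards [ht.eventually hγ] with s hs
  exact velocity_comp_add (hs.mdifferentiableAt (by simp))

omit [IsManifold I ∞ M] in
theorem IsGeodesic.comp_add {E' : Type*} [NormedAddCommGroup E']
    [NormedSpace ℝ E'] {H' : Type*} [TopologicalSpace H'] {J : ModelWithCorners ℝ E' H'}
    [J.Boundaryless] {N' : Type*} [TopologicalSpace N'] [ChartedSpace H' N'] [IsManifold J ∞ N']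
    {p : N' → M} {S : TangentBundle J N' → TangentBundle J.tangent (TangentBundle J N')}
    {γ : ℝ → N'} {D : Set ℝ} (hD : IsOpen D) (h : IsGeodesic I J p S γ D) (a : ℝ) :
    IsGeodesic I J p S (fun s => γ (s + a)) {s | s + a ∈ D} := by
  have hev := fun t (ht : t + a ∈ D) => eventually_contMDiffAt_of_isOpen hD h.1 ht
  refine ⟨?_, fun t ht => ?_, fun t ht => ?_⟩
  · exact h.1.comp (f := fun s : ℝ => s + a)
      (contMDiff_iff_contDiff.2 (by fun_prop)).contMDiffOn fun s hs => hs
  · rw [(eventually_velocity_comp_add (hev t ht)).self_of_nhds]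
    exact h.2.1 (t + a) ht
  · rw [velocity_congr (eventually_velocity_comp_add (hev t ht)),
      velocity_comp_add ((contMDiffAt_velocity (hev t ht)).mdifferentiableAt (by simp)),
      (eventually_velocity_comp_add (hev t ht)).self_of_nhds]
    exact h.2.2 (t + a) ht

/-- Since α + βs = (α − βa) + β(s + a), translating the geodesic keeps the field in the parallel
family and changes only the constant coefficient. -/
theorem parallelLift_comp_add [I.Boundaryless] {α β a t : ℝ} {c : ℝ → N}
    (hc : ∀ᶠ s in nhds (t + a), ContMDiffAt 𝓘(ℝ, ℝ) I ∞ c s) :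
    parallelLift I α β (fun s => c (s + a)) t = parallelLift I (α - β * a) β c (t + a) := by
  have h1 : parallelField I α β (fun s => c (s + a)) =ᶠ[nhds t]
      fun s => parallelField I (α - β * a) β c (s + a) := by
    filter_upwards [eventually_velocity_comp_add hc] with s hs
    have h2 : α + β * s = α - β * a + β * (s + a) := by ring
    unfold parallelField
    rw [← h2]
    exact congrArg (fun ξ : TangentBundle I N => (⟨ξ.proj, (α + β * s) • ξ.snd⟩ :
      TangentBundle I N)) hs
  unfold parallelLift
  rw [velocity_congr h1,
    velocity_comp_add ((contMDiffAt_parallelField hc).mdifferentiableAt (by simp))]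

/-- Δ describes parallel fields at parameter 0, but `γ` may meet it at another parameter `a`; move
`a` to 0, apply `exists_eqOn_parallelLift`, and move back. -/
theorem Spray.IsGeodesicInP.exists_eqOn [I.Boundaryless] [T2Space M] {S : Spray I M}
    {γ : ℝ → TangentBundle I.tangent (TangentBundle I M)} {D : Set ℝ}
    (hD : IsOpen D) (hD' : D.OrdConnected) (h : S.IsGeodesicInP γ D) :
    ∃ α β : ℝ, Set.EqOn γ (parallelLift I α β fun t => projTT I M (γ t)) D := by
  obtain ⟨hγ, a, ha, hΔ⟩ := h
  have hO : IsOpen {s : ℝ | s + a ∈ D} := hD.preimage (by fun_prop)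
  have hC : {s : ℝ | s + a ∈ D}.OrdConnected := by
    refine ⟨fun x hx y hy z hz => hD'.out hx hy ⟨?_, ?_⟩⟩
    · simpa using hz.1
    · simpa using hz.2
  have hev := fun t (ht : t ∈ D) => eventually_contMDiffAt_of_isOpen hD hγ.1 ht
  obtain ⟨α, β, h1⟩ := exists_eqOn_parallelLift hO hC (by simpa using ha) (hγ.comp_add hD a) (by
    rw [velocity_comp_add (by simpa using (hev a ha).self_of_nhds.mdifferentiableAt (by simp))]
    simpa using hΔ)
  refine ⟨α - β * a, β, fun t ht => ?_⟩
  have h2 := h1 (x := t - a) (by simpa using ht)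
  rw [parallelLift_comp_add (c := fun s => projTT I M (γ s))
    (by
      rw [sub_add_cancel]
      exact ((isGeodesic_projTT hD hγ).eventually hD ht).mono fun _ h => h.smooth)] at h2
  simpa using h2

/-- The value of `κ ∘ J'` at `0` determines the parallel Jacobi field `J`. -/
theorem Spray.eq_of_parallelLift_eq [I.Boundaryless] {S : Spray I M} {c₁ c₂ : ℝ → M}
    {α₁ α₂ β₁ β₂ : ℝ} (h₁ : ∀ᶠ s in nhds 0, S.IsGeodesicAt c₁ s)
    (h₂ : ∀ᶠ s in nhds 0, S.IsGeodesicAt c₂ s)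
    (h : parallelLift I α₁ β₁ c₁ 0 = parallelLift I α₂ β₂ c₂ 0) :
    velocity I c₁ 0 = velocity I c₂ 0 ∧ α₁ = α₂ ∧ β₁ = β₂ := by
  have hc : c₁ 0 = c₂ 0 := congrArg (projTT I M) h
  set p := c₁ 0
  have hp₁ : c₁ 0 ∈ (extChartAt I p).source := mem_extChartAt_source _
  have hp₂ : c₂ 0 ∈ (extChartAt I p).source := by rw [← hc]; exact hp₁
  have hs₁ := h₁.mono fun _ h => h.smooth
  have hs₂ := h₂.mono fun _ h => h.smooth
  have e₁ := (eventually_chart_parallelLift (α := α₁) (β := β₁) hs₁ hp₁).self_of_nhds.2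
  have e₂ := (eventually_chart_parallelLift (α := α₂) (β := β₂) hs₂ hp₂).self_of_nhds.2
  have v₁ := (eventually_chart_velocity hs₁ hp₁).self_of_nhds.2
  have v₂ := (eventually_chart_velocity hs₂ hp₂).self_of_nhds.2
  have g₁ := contDiffAt_deriv (contDiffAt_extChartAt_comp hs₁.self_of_nhds hp₁)
  have g₂ := contDiffAt_deriv (contDiffAt_extChartAt_comp hs₂.self_of_nhds hp₂)
  rw [deriv_linear_smul (hasDerivAt_of_contDiffAt g₁).differentiableAt] at e₁
  rw [deriv_linear_smul (hasDerivAt_of_contDiffAt g₂).differentiableAt, ← h, e₁] at e₂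
  have q₁ := (eventually_chart_equation h₁ hp₁).self_of_nhds
  have q₂ := (eventually_chart_equation h₂ hp₂).self_of_nhds
  simp only [Prod.mk.injEq, mul_zero, add_zero] at e₂
  obtain ⟨⟨f1, f2⟩, f3, f4⟩ := e₂
  -- Regularity of `c₁` is what allows the scalars α and β to be cancelled below.
  have hne : deriv (extChartAt I p ∘ c₁) 0 ≠ 0 := by
    have := ((tangentChart_mem_slashedDomain (p := p) (ξ := velocity I c₁ 0) hp₁).2
      h₁.self_of_nhds.regular).2
    rwa [v₁] at this
  -- Position and velocity agree, so the geodesic equation identifies the second derivatives of the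
  -- two curves.
  rw [q₂, ← f1, ← f2, ← q₁] at f4
  rw [← f2] at f3
  have hα : α₁ = α₂ := smul_left_injective ℝ hne f3
  rw [hα] at f4
  refine ⟨?_, hα, smul_left_injective ℝ hne (add_right_cancel f4)⟩
  apply (tangentChart I p).injOn
  · exact (mem_extChartAt_tangent_source I _ _).2 hp₁
  · exact (mem_extChartAt_tangent_source I _ _).2 hp₂
  · rw [v₁, v₂, f1, f2]

/-- A geodesic in the phase space `P` is determined by its initial point. -/
theorem Spray.IsGeodesicInP.eqOn [I.Boundaryless] [T2Space M] {S : Spray I M} {I₁ I₂ : Set ℝ}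
    (hI₁ : IsOpen I₁ ∧ I₁.OrdConnected ∧ 0 ∈ I₁) (hI₂ : IsOpen I₂ ∧ I₂.OrdConnected ∧ 0 ∈ I₂)
    {γ₁ γ₂ : ℝ → TangentBundle I.tangent (TangentBundle I M)}
    (h₁ : S.IsGeodesicInP γ₁ I₁) (h₂ : S.IsGeodesicInP γ₂ I₂) (h : γ₁ 0 = γ₂ 0) :
    Set.EqOn γ₁ γ₂ (I₁ ∩ I₂) := by
  obtain ⟨α₁, β₁, e₁⟩ := h₁.exists_eqOn hI₁.1 hI₁.2.1
  obtain ⟨α₂, β₂, e₂⟩ := h₂.exists_eqOn hI₂.1 hI₂.2.1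
  set c₁ := fun t => projTT I M (γ₁ t)
  set c₂ := fun t => projTT I M (γ₂ t)
  have hc₁ : S.IsGeodesic c₁ I₁ := isGeodesic_projTT hI₁.1 h₁.1
  have hc₂ : S.IsGeodesic c₂ I₂ := isGeodesic_projTT hI₂.1 h₂.1
  rw [e₁ hI₁.2.2, e₂ hI₂.2.2] at h
  obtain ⟨hv, rfl, rfl⟩ := eq_of_parallelLift_eq (hc₁.eventually hI₁.1 hI₁.2.2)
    (hc₂.eventually hI₂.1 hI₂.2.2) h
  have hO := hI₁.1.inter hI₂.1
  have hc : Set.EqOn c₁ c₂ (I₁ ∩ I₂) := by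
    -- Both projections are geodesics of S with the same velocity at 0, so they agree on the whole
    -- intersection.
    refine eqOn_of_velocity_eq (S := S.toMap) hO (hI₁.2.1.inter hI₂.2.1)
      (hc₁.1.mono Set.inter_subset_left) (hc₂.1.mono Set.inter_subset_right) (fun t ht => ?_)
      (fun t ht => hc₁.2.2 t ht.1) (fun t ht => hc₂.2.2 t ht.2) ⟨hI₁.2.2, hI₂.2.2⟩ hv
    exact ⟨c₁ t, _, _, S.secondOrderRep (c₁ t), mem_extChartAt_source _,
      (tangentChart_mem_slashedDomain (ξ := velocity I c₁ t) (mem_extChartAt_source _)).2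
        (hc₁.eventually hI₁.1 ht.1).self_of_nhds.regular⟩
  intro t ht
  rw [e₁ ht.1, e₂ ht.2]
  -- The lift at `t` involves derivatives of the base curve, so equality near `t` is used; the
  -- intersection is open.
  refine (parallelLift_congr ?_).self_of_nhds
  filter_upwards [hO.mem_nhds ht] with s hs using hc hs

end Translation

end SprayGeometry

end

theorem mainTheorem3 (n : ℕ) (hn : 1 ≤ n)
    (M : Type*) [TopologicalSpace M] [T2Space M] [SecondCountableTopology M]
    [ChartedSpace (EuclideanSpace ℝ (Fin n)) M] [IsManifold (𝓡 n) ∞ M]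
    (S : SprayGeometry.Spray (𝓡 n) M)
    (I₁ I₂ : Set ℝ)
    (hI₁ : IsOpen I₁ ∧ I₁.OrdConnected ∧ 0 ∈ I₁)
    (hI₂ : IsOpen I₂ ∧ I₂.OrdConnected ∧ 0 ∈ I₂)
    (γ₁ γ₂ : ℝ → TangentBundle (𝓡 n).tangent (TangentBundle (𝓡 n) M))
    (h₁ : S.IsGeodesicInP γ₁ I₁) (h₂ : S.IsGeodesicInP γ₂ I₂)
    (h : γ₁ 0 = γ₂ 0) :
    Set.EqOn γ₁ γ₂ (I₁ ∩ I₂) := by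
  exact h₁.eqOn hI₁ hI₂ h₂ h
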